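/- Let $c,\lambda,t>0$. Let $V(0)$ be a random variable with $P\{V(0)=c\}=P\{V(0)=-c\}=\tfrac12$, let $N$ be a homogeneous Poisson process of rate $\lambda$ independent of $V(0)$, and let $\mathcal T(s)=\int_0^s V(0)(-1)^{N(r)}\,dr$, $s\ge 0$, be the symmetric telegraph process. Let $M_t=\max_{0\le s\le t}\mathcal T(s)$ (the maximum is almost surely attained), and let $I_n(x)=\sum_{k\ge 0}\frac{(x/2)^{2k+n}}{k!\,(k+n)!}$ be the modified Bessel functions. Then for $0<\beta<ct$: (i) $\displaystyle P\{M_t\in d\beta,\ N(t)\text{ even}\mid V(0)=c\}=\frac{e^{-\lambda t}\lambda t}{\sqrt{c^2t^2-\beta^2}}\,I_1\Bigl(\frac{\lambda}{c}\sqrt{c^2t^2-\beta^2}\Bigr)d\beta=\frac{e^{-\lambda t}}{c}\,\frac{\partial}{\partial t}I_0\Bigl(\frac{\lambda}{c}\sqrt{c^2t^2-\beta^2}\Bigr)d\beta$ (in particular, the derivative exists); (ii) $\displaystyle P\{M_t\in d\beta,\ N(t)\text{ odd}\mid V(0)=c\}=\frac{\lambda e^{-\lambda t}}{c}\,I_0\Bigl(\frac{\lambda}{c}\sqrt{c^2t^2-\beta^2}\Bigr)d\beta$;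 (iii) $\displaystyle P\{M_t\in d\beta\mid V(0)=c\}=\frac{e^{-\lambda t}}{c}\Bigl[\lambda I_0\Bigl(\frac{\lambda}{c}\sqrt{c^2t^2-\beta^2}\Bigr)+\frac{\partial}{\partial t}I_0\Bigl(\frac{\lambda}{c}\sqrt{c^2t^2-\beta^2}\Bigr)\Bigr]d\beta=2P\{\mathcal T(t)\in d\beta\}$, where the last probability is not conditioned on $V(0)$. Here $P\{M_t\in d\beta,\dots\}=f(\beta)\,d\beta$ means that $P\{M_t\in B,\dots\}=\int_B f(\beta)\,d\beta$ for every Borel set $B\subseteq(0,ct)$. Consequently the law of $M_t$ given $V(0)=c$ is the (unconditional) law of $|\mathcal T(t)|$ on all of $\mathbb R$, and it has an atom at $ct$: $P\{M_t=ct\mid V(0)=c\}=e^{-\lambda t}$. -/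

import Mathlib

open MeasureTheory ProbabilityTheory Set
open scoped NNReal ENNReal

noncomputable section

/-- The modified Bessel function of the first kind of order `n`,
`I_n(x) = ∑_{k ≥ 0} (x/2)^(2k+n) / (k! (k+n)!)`. -/
def besselI (n : ℕ) (x : ℝ) : ℝ :=
  ∑' k : ℕ, (x / 2) ^ (2 * k + n) / ((k.factorial : ℝ) * ((k + n).factorial : ℝ))

/-- `N` is a homogeneous Poisson process of rate `lam`: it counts the arrivals in `[0, t]`, where
the interarrival times `ξ 0, ξ 1, …` are independent and exponential of rate `lam`, so that the
arrival times are the partial sums `ξ 0 + … + ξ n`. -/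
structure IsPoissonProcess {Ω : Type*} [MeasurableSpace Ω] (P : Measure Ω) (lam : ℝ)
    (N : ℝ≥0 → Ω → ℕ) : Prop where
  measurable : ∀ t, Measurable (N t)
  exists_interarrival : ∃ ξ : ℕ → Ω → ℝ,
    (∀ n, Measurable (ξ n)) ∧ iIndepFun ξ P ∧ (∀ n, HasLaw (ξ n) (expMeasure lam) P) ∧
    ∀ᵐ ω ∂P, ∀ t : ℝ≥0,
      (N t ω : ℕ∞) = Set.encard {n : ℕ | ∑ i ∈ Finset.range (n + 1), ξ i ω ≤ (t : ℝ)}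

/-- The telegraph process `𝒯(t) = ∫₀ᵗ V(0) (-1)^{N(s)} ds`. -/
def telegraph {Ω : Type*} (V : Ω → ℝ) (N : ℝ≥0 → Ω → ℕ) (t : ℝ) (ω : Ω) : ℝ :=
  ∫ s in (0 : ℝ)..t, V ω * (-1) ^ N s.toNNReal ω

/-- The maximum of the telegraph process over `[0, t]`. -/
def telegraphMax {Ω : Type*} (V : Ω → ℝ) (N : ℝ≥0 → Ω → ℕ) (t : ℝ) (ω : Ω) : ℝ :=
  sSup ((fun s => telegraph V N s ω) '' Icc 0 t)

/-- `Q{X ∈ dx, A} = f(x) dx` for `x ∈ I`. -/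
structure HasDensityOn {Ω : Type*} [MeasurableSpace Ω] (Q : Measure Ω) (X : Ω → ℝ) (A : Set Ω)
    (I : Set ℝ) (f : ℝ → ℝ) : Prop where
  nonneg : ∀ x ∈ I, 0 ≤ f x
  aemeasurable : AEMeasurable f (volume.restrict I)
  measure_eq : ∀ B : Set ℝ, MeasurableSet B → B ⊆ I →
    Q (X ⁻¹' B ∩ A) = ∫⁻ x in B, ENNReal.ofReal (f x)

/-- `I₀((λ/c) √(c²t² - β²))` as a function of `t` and `β`. -/
def besselKernel (lam c t β : ℝ) : ℝ :=
  besselI 0 (lam / c * Real.sqrt (c ^ 2 * t ^ 2 - β ^ 2))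

end

/-! After scaling to speed one, the event of exactly `n` reversals in `[0, t]` carries the weight
`exp (-lam * t) * lam ^ n` times Lebesgue measure on the ordered arrival times. The problem thus
reduces, for each `n`, to volumes of sets of arrival configurations.

Put `p = (t + b) / 2` and `q = (t - b) / 2`. A path started upwards ends above `b` iff it moves
upwards for longer than `p`. Since the spacings of the arrivals are exchangeable, the volume of this
event should be that of configurations with at least as many arrivals in the last stretch of length
`q` as in the first of length `p`, which is `truncBinom n 0 p q`. Likewise ending below `-b` should
give `truncBinom n 1 p q`. This explains the formulas; they are proved by induction on `n`,
conditioning on the first arrival (`interarrivalLaw_first_step`), since integrating over the first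
arrival only shifts the threshold of `truncBinom`.

The same induction, run jointly for upward and downward starts, gives the volume `truncBinom n 0 p q
+ truncBinom n 1 p q` for a maximum above `b` (`interarrivalLaw_pathMax`). Hence the maximum and the
absolute position have the same law for every `n` (`maxLaw_eq_absLaw`), which is the reflection
principle; a symmetric initial velocity then turns the folded law into the unconditional one.

For the densities, the `b`-derivative of the tail telescopes to one central monomial for odd `n` and
to two middle ones for even `n` (`hasDerivAt_maxTail_odd`, `hasDerivAt_maxTail_even`). Summed over
`n`, these are the series of `I_0` and of its time derivative. The case `n = 0` is the atom at `c *
t`.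

The rest is transfer: `IsCounting.unitPath_spec` matches the recursions with the integral defining
the process, and `IsPoissonProcess.exists_indepFun` passes from independence of the process to
independence of its interarrival times. -/

noncomputable section

/-! ### Truncated binomial sums -/

/-- The terms `p ^ i q ^ j / (i! j!)` of the expansion of `(p + q) ^ n / n!` with `k ≤ j - i`. -/
def truncBinom (n : ℕ) (k : ℤ) (p q : ℝ) : ℝ :=
  ∑ x ∈ Finset.HasAntidiagonal.antidiagonal n,
    if k ≤ (x.2 : ℤ) - x.1 then
      p ^ x.1 / (x.1.factorial : ℝ) * (q ^ x.2 / (x.2.factorial : ℝ)) else 0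

lemma hasDerivAt_pow_div_factorial {u : ℝ → ℝ} {u' x : ℝ} (hu : HasDerivAt u u' x) (n : ℕ) :
    HasDerivAt (fun y => u y ^ (n + 1) / ((n + 1).factorial : ℝ))
      (u x ^ n / (n.factorial : ℝ) * u') x := by
  have h := (hu.pow (n + 1)).div_const ((n + 1).factorial : ℝ)
  refine h.congr_deriv ?_
  have h1 : (n.factorial : ℝ) ≠ 0 := by positivity
  have h2 : (n : ℝ) + 1 ≠ 0 := by positivity
  rw [Nat.factorial_succ]
  push_cast
  field_simp

/-- Differentiating in `p` lowers `i` by one and so raises `j - i`; differentiating in `q` does the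
opposite. The family is therefore closed under the integrations over the first arrival. -/
lemma hasDerivAt_truncBinom_succ {u v : ℝ → ℝ} {u' v' x : ℝ} (hu : HasDerivAt u u' x)
    (hv : HasDerivAt v v' x) (n : ℕ) (k : ℤ) :
    HasDerivAt (fun y => truncBinom (n + 1) k (u y) (v y))
      (truncBinom n (k + 1) (u x) (v x) * u' + truncBinom n (k - 1) (u x) (v x) * v') x := by
  have hpow : ∀ {w : ℝ → ℝ} {w' : ℝ}, HasDerivAt w w' x → ∀ i : ℕ,
      HasDerivAt (fun y => w y ^ i / (i.factorial : ℝ))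
        ((if i = 0 then 0 else w x ^ (i - 1) / ((i - 1).factorial : ℝ)) * w') x := by
    intro w w' hw i
    cases i with
    | zero => simpa using hasDerivAt_const x (1 : ℝ)
    | succ i => simpa using hasDerivAt_pow_div_factorial hw i
  have key : ∀ z ∈ Finset.HasAntidiagonal.antidiagonal (n + 1), HasDerivAt (fun y =>
      if k ≤ (z.2 : ℤ) - z.1 then
        u y ^ z.1 / (z.1.factorial : ℝ) * (v y ^ z.2 / (z.2.factorial : ℝ)) else 0)
      ((if k ≤ (z.2 : ℤ) - z.1 then
        (if z.1 = 0 then 0 else u x ^ (z.1 - 1) / ((z.1 - 1).factorial : ℝ)) *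
          (v x ^ z.2 / (z.2.factorial : ℝ)) else 0) * u' +
      (if k ≤ (z.2 : ℤ) - z.1 then
        u x ^ z.1 / (z.1.factorial : ℝ) *
        (if z.2 = 0 then 0 else v x ^ (z.2 - 1) / ((z.2 - 1).factorial : ℝ)) else 0) * v') x := by
    intro z _
    by_cases hz : k ≤ (z.2 : ℤ) - z.1
    · simp only [if_pos hz]
      exact ((hpow hu z.1).mul (hpow hv z.2)).congr_deriv (by ring)
    · simpa only [if_neg hz, zero_mul, add_zero] using hasDerivAt_const x (0 : ℝ)
  refine (HasDerivAt.fun_sum key).congr_deriv ?_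
  rw [Finset.sum_add_distrib, ← Finset.sum_mul, ← Finset.sum_mul, truncBinom, truncBinom]
  congr 2
  · rw [Finset.Nat.sum_antidiagonal_succ]
    simp only [if_true, zero_mul, ite_self, zero_add]
    refine Finset.sum_congr rfl fun z _ => ?_
    have : (k ≤ (z.2 : ℤ) - ((z.1 + 1 : ℕ) : ℤ)) ↔ k + 1 ≤ (z.2 : ℤ) - z.1 := by
      push_cast; constructor <;> intro h <;> linarith
    simp only [this, Nat.add_eq_zero_iff, one_ne_zero, and_false, if_false, Nat.add_sub_cancel]
  · rw [Finset.Nat.sum_antidiagonal_succ']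
    simp only [if_true, mul_zero, ite_self, zero_add]
    refine Finset.sum_congr rfl fun z _ => ?_
    have : (k ≤ ((z.2 + 1 : ℕ) : ℤ) - (z.1 : ℤ)) ↔ k - 1 ≤ (z.2 : ℤ) - z.1 := by
      push_cast; constructor <;> intro h <;> linarith
    simp only [this, Nat.add_eq_zero_iff, one_ne_zero, and_false, if_false, Nat.add_sub_cancel]

lemma continuous_truncBinom (n : ℕ) (k : ℤ) {α : Type*} [TopologicalSpace α] {u v : α → ℝ}
    (hu : Continuous u) (hv : Continuous v) : Continuous fun y => truncBinom n k (u y) (v y) := by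
  unfold truncBinom
  refine continuous_finsetSum _ fun z _ => ?_
  split_ifs <;> fun_prop

lemma truncBinom_nonneg (n : ℕ) (k : ℤ) {p q : ℝ} (hp : 0 ≤ p) (hq : 0 ≤ q) :
    0 ≤ truncBinom n k p q := by
  refine Finset.sum_nonneg fun z _ => ?_
  split_ifs <;> positivity

/-- If `j ≥ i` and `i + j ≥ 1`, then `j ≥ 1`, so every retained term contains a factor `0`. -/
lemma truncBinom_succ_right_zero (n : ℕ) {k : ℤ} (hk : 0 ≤ k) (p : ℝ) :
    truncBinom (n + 1) k p 0 = 0 := by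
  refine Finset.sum_eq_zero fun z hz => ?_
  rw [Finset.HasAntidiagonal.mem_antidiagonal] at hz
  split_ifs with h
  · have : z.2 ≠ 0 := by omega
    simp [this]
  · rfl

lemma truncBinom_zero_left_zero (n : ℕ) (q : ℝ) :
    truncBinom n 0 0 q = q ^ n / (n.factorial : ℝ) := by
  unfold truncBinom
  cases n with
  | zero => simp
  | succ n =>
    rw [Finset.Nat.sum_antidiagonal_succ]
    have : (0 : ℤ) ≤ ((n + 1 : ℕ) : ℤ) - ((0 : ℕ) : ℤ) := by omega
    simp only [if_pos this]
    simp

/-- On the diagonal, exchanging `i` and `j` turns the terms with `j - i ≥ 1` into those with `j - i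
< 0`, which complete the binomial expansion. -/
lemma truncBinom_add_truncBinom_self (n : ℕ) (q : ℝ) :
    truncBinom n 0 q q + truncBinom n 1 q q = (2 * q) ^ n / (n.factorial : ℝ) := by
  have hswap : truncBinom n 1 q q = ∑ x ∈ Finset.HasAntidiagonal.antidiagonal n,
      if ¬ (0 : ℤ) ≤ (x.2 : ℤ) - x.1 then
        q ^ x.1 / (x.1.factorial : ℝ) * (q ^ x.2 / (x.2.factorial : ℝ)) else 0 := by
    unfold truncBinom
    rw [← Finset.Nat.sum_antidiagonal_swap]
    refine Finset.sum_congr rfl fun z _ => ?_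
    simp only [Prod.fst_swap, Prod.snd_swap]
    refine if_congr ?_ (mul_comm _ _) rfl
    omega
  rw [hswap, truncBinom, ← Finset.sum_add_distrib, two_mul, (Commute.all q q).add_pow',
    Finset.sum_div]
  refine Finset.sum_congr rfl fun z hz => ?_
  rw [Finset.HasAntidiagonal.mem_antidiagonal] at hz
  have h : ((n.choose z.1 : ℕ) : ℝ) * (z.1.factorial : ℝ) * (z.2.factorial : ℝ) = n.factorial := by
    rw [← hz]; exact_mod_cast (Nat.choose_symm_add (a := z.1) (b := z.2)).symm ▸
      Nat.add_choose_mul_factorial_mul_factorial z.1 z.2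
  have h1 : (z.1.factorial : ℝ) ≠ 0 := by positivity
  have h2 : (z.2.factorial : ℝ) ≠ 0 := by positivity
  have h3 : (n.factorial : ℝ) ≠ 0 := by positivity
  have h4 : q ^ z.1 / (z.1.factorial : ℝ) * (q ^ z.2 / (z.2.factorial : ℝ)) =
      n.choose z.1 • (q ^ z.1 * q ^ z.2) / (n.factorial : ℝ) := by
    rw [nsmul_eq_mul, div_mul_div_comm, div_eq_div_iff (mul_ne_zero h1 h2) h3, ← h]
    ring
  rw [← h4]
  split_ifs <;> simp

lemma truncBinom_sub (n : ℕ) (k : ℤ) (p q : ℝ) :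
    truncBinom n k p q - truncBinom n (k + 1) p q = ∑ x ∈ Finset.HasAntidiagonal.antidiagonal n,
      if (x.2 : ℤ) - x.1 = k then
        p ^ x.1 / (x.1.factorial : ℝ) * (q ^ x.2 / (x.2.factorial : ℝ)) else 0 := by
  rw [truncBinom, truncBinom, ← Finset.sum_sub_distrib]
  refine Finset.sum_congr rfl fun z _ => ?_
  rcases lt_trichotomy ((z.2 : ℤ) - z.1) k with h | h | h
  · rw [if_neg (by omega), if_neg (by omega), if_neg (by omega), sub_zero]
  · rw [if_pos (by omega), if_neg (by omega), if_pos (by omega), sub_zero]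
  · rw [if_pos (by omega), if_pos (by omega), if_neg (by omega), sub_self]

lemma truncBinom_sub_eq_single (i j : ℕ) (p q : ℝ) :
    truncBinom (i + j) (j - i) p q - truncBinom (i + j) (j - i + 1) p q =
      p ^ i / (i.factorial : ℝ) * (q ^ j / (j.factorial : ℝ)) := by
  rw [truncBinom_sub, Finset.sum_eq_single_of_mem (i, j) (by simp)]
  · simp
  · rintro ⟨a, b⟩ hz hne
    rw [Finset.HasAntidiagonal.mem_antidiagonal] at hz
    refine if_neg fun h => hne ?_
    simp only at hz h
    ext <;> simp <;> omega

/-- The difference `j - i` has the parity of `i + j = n`, so a threshold of the wrong parity may be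
raised by one without losing a term. -/
lemma truncBinom_sub_eq_zero (n : ℕ) (k : ℤ) (h : ¬ Even (n + k)) (p q : ℝ) :
    truncBinom n k p q = truncBinom n (k + 1) p q := by
  rw [← sub_eq_zero, truncBinom_sub]
  refine Finset.sum_eq_zero fun z hz => if_neg fun hk => h ?_
  rw [Finset.HasAntidiagonal.mem_antidiagonal] at hz
  exact ⟨z.2, by omega⟩

/-! ### Tails of the maximum and their derivatives -/

/-- The `n`-th order term of `P{max > b}` for the unit speed telegraph process started upwards. -/
def maxTail (n : ℕ) (t b : ℝ) : ℝ :=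
  truncBinom n 0 ((t + b) / 2) ((t - b) / 2) + truncBinom n 1 ((t + b) / 2) ((t - b) / 2)

lemma hasDerivAt_maxTail_succ (m : ℕ) (t b : ℝ) :
    HasDerivAt (maxTail (m + 1) t)
      ((truncBinom m 1 ((t + b) / 2) ((t - b) / 2) + truncBinom m 2 ((t + b) / 2) ((t - b) / 2)
        - truncBinom m (-1) ((t + b) / 2) ((t - b) / 2)
        - truncBinom m 0 ((t + b) / 2) ((t - b) / 2)) / 2) b := by
  have hu : HasDerivAt (fun y : ℝ => (t + y) / 2) (1 / 2) b :=
    ((hasDerivAt_id b).const_add t).div_const 2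
  have hv : HasDerivAt (fun y : ℝ => (t - y) / 2) (-1 / 2) b :=
    ((hasDerivAt_id b).const_sub t).div_const 2
  refine ((hasDerivAt_truncBinom_succ hu hv m 0).add
    (hasDerivAt_truncBinom_succ hu hv m 1)).congr_deriv ?_
  norm_num
  ring

/-- By parity the thresholds `-1, 0` agree and so do `1, 2`; what remains is minus the central
monomial `p ^ k q ^ k / k! ^ 2`. -/
lemma hasDerivAt_maxTail_odd (k : ℕ) (t b : ℝ) :
    HasDerivAt (maxTail (2 * k + 1) t)
      (-(((t ^ 2 - b ^ 2) / 4) ^ k / ((k.factorial : ℝ) * k.factorial))) b := by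
  refine (hasDerivAt_maxTail_succ (2 * k) t b).congr_deriv ?_
  have h0 := truncBinom_sub_eq_single k k ((t + b) / 2) ((t - b) / 2)
  rw [sub_self, zero_add, ← two_mul] at h0
  have h1 := truncBinom_sub_eq_zero (2 * k) (-1)
    (by rw [Int.not_even_iff_odd]; exact ⟨k - 1, by push_cast; ring⟩)
    ((t + b) / 2) ((t - b) / 2)
  have h2 := truncBinom_sub_eq_zero (2 * k) 1
    (by rw [Int.not_even_iff_odd]; exact ⟨k, by push_cast; ring⟩)
    ((t + b) / 2) ((t - b) / 2)
  norm_num at h1 h2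
  rw [h1, ← h2, show (t ^ 2 - b ^ 2) / 4 = (t + b) / 2 * ((t - b) / 2) by ring, mul_pow,
    ← div_mul_div_comm, ← h0]
  ring

/-- Here thresholds `0` and `1` agree, leaving the two monomials next to the centre. Their sum
contains `(p * q) ^ k * (p + q)`, and `p + q = t` produces the factor `t`. -/
lemma hasDerivAt_maxTail_even (k : ℕ) (t b : ℝ) :
    HasDerivAt (maxTail (2 * k + 2) t)
      (-(t / 2 * (((t ^ 2 - b ^ 2) / 4) ^ k / ((k.factorial : ℝ) * (k + 1).factorial)))) b := by
  refine (hasDerivAt_maxTail_succ (2 * k + 1) t b).congr_deriv ?_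
  have h0 := truncBinom_sub_eq_single (k + 1) k ((t + b) / 2) ((t - b) / 2)
  have h1 := truncBinom_sub_eq_single k (k + 1) ((t + b) / 2) ((t - b) / 2)
  have h2 := truncBinom_sub_eq_zero (2 * k + 1) 0
    (by rw [Int.not_even_iff_odd]; exact ⟨k, by push_cast; ring⟩)
    ((t + b) / 2) ((t - b) / 2)
  rw [show k + 1 + k = 2 * k + 1 by ring] at h0
  rw [show k + (k + 1) = 2 * k + 1 by ring] at h1
  push_cast at h0 h1
  rw [show (k : ℤ) - (k + 1) = -1 by ring] at h0
  rw [show (k : ℤ) + 1 - k = 1 by ring] at h1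
  norm_num at h0 h1 h2
  have h3 : (truncBinom (2 * k + 1) 1 ((t + b) / 2) ((t - b) / 2) +
      truncBinom (2 * k + 1) 2 ((t + b) / 2) ((t - b) / 2)
        - truncBinom (2 * k + 1) (-1) ((t + b) / 2) ((t - b) / 2)
        - truncBinom (2 * k + 1) 0 ((t + b) / 2) ((t - b) / 2)) / 2 =
      - ((((t + b) / 2) ^ (k + 1) / ((k + 1).factorial : ℝ) * (((t - b) / 2) ^ k /
          (k.factorial : ℝ))) +
       ((t + b) / 2) ^ k / (k.factorial : ℝ) * (((t - b) / 2) ^ (k + 1) /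
           ((k + 1).factorial : ℝ))) / 2 := by
    rw [← h0, ← h1]; linarith
  rw [h3, show (t ^ 2 - b ^ 2) / 4 = (t + b) / 2 * ((t - b) / 2) by ring, mul_pow]
  field_simp
  ring

/-! ### Bessel functions as power series in the squared argument -/

/-- The entire function `∑ y ^ k / (k! (k + j)!)`. -/
def besselSeries (j : ℕ) (y : ℝ) : ℝ :=
  ∑' k : ℕ, y ^ k / ((k.factorial : ℝ) * ((k + j).factorial : ℝ))

lemma besselI_eq (n : ℕ) (x : ℝ) : besselI n x = (x / 2) ^ n * besselSeries n (x ^ 2 / 4) := by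
  rw [besselI, besselSeries, ← tsum_mul_left]
  refine tsum_congr fun k => ?_
  rw [pow_add, pow_mul, div_pow x 2 2]
  norm_num
  ring

lemma summable_besselSeries (j : ℕ) (y : ℝ) :
    Summable fun k : ℕ => y ^ k / ((k.factorial : ℝ) * ((k + j).factorial : ℝ)) := by
  refine .of_norm_bounded (Real.summable_pow_div_factorial |y|) fun k => ?_
  rw [Real.norm_eq_abs, abs_div, abs_pow, abs_of_pos (by positivity : (0 : ℝ) < (k.factorial : ℝ) *
    ((k + j).factorial : ℝ))]
  have h : (1 : ℝ) ≤ ((k + j).factorial : ℝ) := by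
    exact_mod_cast Nat.one_le_iff_ne_zero.2 (Nat.factorial_ne_zero _)
  have h' : (0 : ℝ) < k.factorial := by positivity
  gcongr
  nlinarith

lemma hasDerivAt_besselSeries (j : ℕ) (y : ℝ) :
    HasDerivAt (besselSeries j) (besselSeries (j + 1) y) y := by
  set R : ℝ := |y| + 1
  have hR : 0 ≤ R := by positivity
  have hterm : ∀ k : ℕ, ∀ z : ℝ, ((k + 1 : ℕ) : ℝ) * z ^ (k + 1 - 1) /
      (((k + 1).factorial : ℝ) * ((k + 1 + j).factorial : ℝ)) =
      z ^ k / ((k.factorial : ℝ) * ((k + (j + 1)).factorial : ℝ)) := by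
    intro k z
    rw [Nat.factorial_succ k, show k + 1 + j = k + (j + 1) by ring]
    push_cast
    field_simp
  -- At `k = 0` the truncated exponent `k - 1` is harmless because the factor `k` vanishes; dropping
  -- this term shifts the index and turns `j` into `j + 1`.
  have hsum : ∀ z : ℝ, Summable fun k : ℕ => (k : ℝ) * z ^ (k - 1) /
      ((k.factorial : ℝ) * ((k + j).factorial : ℝ)) := by
    intro z
    rw [← summable_nat_add_iff 1]
    exact (summable_besselSeries (j + 1) z).congr fun k => (hterm k z).symm
  have h := hasDerivAt_tsum_of_isPreconnected (hsum R) (t := Ioo (-R) R) isOpen_Ioo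
    isPreconnected_Ioo (y₀ := y)
    (g := fun k z => z ^ k / ((k.factorial : ℝ) * ((k + j).factorial : ℝ)))
    (g' := fun k z => (k : ℝ) * z ^ (k - 1) / ((k.factorial : ℝ) * ((k + j).factorial : ℝ)))
    (fun k z _ => (hasDerivAt_pow k z).div_const _) ?_ ?_ (summable_besselSeries j y) (y := y) ?_
  · refine h.congr_deriv ?_
    rw [(hsum y).tsum_eq_zero_add]
    simp only [Nat.cast_zero, zero_mul, zero_div, zero_add]
    exact tsum_congr fun k => hterm k y
  · intro k z hz
    have hz' : |z| ≤ R := abs_le.2 ⟨hz.1.le, hz.2.le⟩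
    rw [Real.norm_eq_abs, abs_div, abs_mul, abs_pow, abs_of_nonneg (Nat.cast_nonneg k),
      abs_of_pos (by positivity : (0 : ℝ) < (k.factorial : ℝ) * ((k + j).factorial : ℝ))]
    gcongr
  all_goals exact ⟨by have := neg_abs_le y; simp only [R]; linarith,
    by have := le_abs_self y; simp only [R]; linarith⟩

lemma besselKernel_eq {lam c u β : ℝ} (hc : 0 < c) (h : 0 ≤ c ^ 2 * u ^ 2 - β ^ 2) :
    besselKernel lam c u β = besselSeries 0 (lam ^ 2 * ((u ^ 2 - (β / c) ^ 2) / 4)) := by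
  rw [besselKernel, besselI_eq, pow_zero, one_mul, mul_pow, Real.sq_sqrt h]
  congr 1
  field_simp

lemma sq_sub_sq_pos_of_mem_Ioo {c t β : ℝ} (hβ : β ∈ Ioo 0 (c * t)) :
    0 < c ^ 2 * t ^ 2 - β ^ 2 := by
  have := hβ.1
  have := hβ.2
  nlinarith

lemma hasDerivAt_besselKernel {lam c t β : ℝ} (hc : 0 < c) (hβ : β ∈ Ioo 0 (c * t)) :
    HasDerivAt (fun u => besselKernel lam c u β)
      (lam ^ 2 * t / 2 * besselSeries 1 (lam ^ 2 * ((t ^ 2 - (β / c) ^ 2) / 4))) t := by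
  have hpos := sq_sub_sq_pos_of_mem_Ioo hβ
  -- The square root disappears from the kernel only where the radicand is nonnegative, so the power
  -- series is used on a neighbourhood of `t`.
  have hev : ∀ᶠ u in nhds t, 0 < c ^ 2 * u ^ 2 - β ^ 2 := by
    have hcont : Continuous fun u : ℝ => c ^ 2 * u ^ 2 - β ^ 2 := by fun_prop
    exact hcont.continuousAt.eventually_const_lt hpos
  have hin : HasDerivAt (fun u : ℝ => lam ^ 2 * ((u ^ 2 - (β / c) ^ 2) / 4)) (lam ^ 2 * t / 2) t :=
    ((((hasDerivAt_pow 2 t).sub_const _).div_const 4).const_mul _).congr_deriv (by norm_num; ring)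
  have := (hasDerivAt_besselSeries 0 _).comp t hin
  rw [zero_add, mul_comm] at this
  exact this.congr_of_eventuallyEq (hev.mono fun u hu => besselKernel_eq hc hu.le)

lemma besselI_one_sqrt {lam c t β : ℝ} (hc : 0 < c) (hβ : β ∈ Ioo 0 (c * t)) :
    c * (lam * t / Real.sqrt (c ^ 2 * t ^ 2 - β ^ 2) *
        besselI 1 (lam / c * Real.sqrt (c ^ 2 * t ^ 2 - β ^ 2))) =
      lam ^ 2 * t / 2 * besselSeries 1 (lam ^ 2 * ((t ^ 2 - (β / c) ^ 2) / 4)) := by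
  have hpos := sq_sub_sq_pos_of_mem_Ioo hβ
  have hs : Real.sqrt (c ^ 2 * t ^ 2 - β ^ 2) ≠ 0 := (Real.sqrt_pos.2 hpos).ne'
  rw [besselI_eq, mul_pow, Real.sq_sqrt hpos.le, show (lam / c) ^ 2 * (c ^ 2 * t ^ 2 - β ^ 2) / 4 =
    lam ^ 2 * ((t ^ 2 - (β / c) ^ 2) / 4) by field_simp]
  field_simp

/-! ### Densities from tails -/

/-- A finite measure on the line whose tail is differentiable has minus the derivative as
density. -/
lemma measure_eq_setLIntegral_of_tail {ρ : Measure ℝ} [IsFiniteMeasure ρ] {L : ℝ} {F f : ℝ → ℝ}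
    (hF : ∀ b, 0 ≤ b → b < L → ρ (Ioi b) = ENNReal.ofReal (F b))
    (hF0 : ∀ b, 0 ≤ b → b < L → 0 ≤ F b)
    (hderiv : ∀ b, HasDerivAt F (-f b) b)
    (hf : Continuous f) (hf0 : ∀ b, 0 < b → b < L → 0 ≤ f b) {B : Set ℝ} (hB : MeasurableSet B)
    (hBL : B ⊆ Ioo 0 L) : ρ B = ∫⁻ x in B, ENNReal.ofReal (f x) := by
  set ν : Measure ℝ := volume.withDensity fun x => ENNReal.ofReal (f x)
  have hIoc : ∀ a b, 0 ≤ a → a ≤ b → b < L → ρ (Ioc a b) = ν (Ioc a b) := by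
    intro a b ha hab hb
    have h1 : ρ (Ioc a b) = ENNReal.ofReal (F a - F b) := by
      rw [← Ioi_sdiff_Ioi, measure_sdiff (Ioi_subset_Ioi hab) nullMeasurableSet_Ioi
          (measure_ne_top _ _),
        hF a ha (hab.trans_lt hb), hF b (ha.trans hab) hb,
        ← ENNReal.ofReal_sub _ (hF0 b (ha.trans hab) hb)]
    rw [h1, withDensity_apply _ measurableSet_Ioc,
      ← ofReal_integral_eq_lintegral_ofReal (hf.integrableOn_Ioc)
        ((ae_restrict_iff' measurableSet_Ioc).2 <| .of_forall fun x hx =>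
          hf0 x (ha.trans_lt hx.1) (hx.2.trans_lt hb)), ← intervalIntegral.integral_of_le hab]
    have := intervalIntegral.integral_eq_sub_of_hasDerivAt (fun x _ => hderiv x)
      (hf.neg.intervalIntegrable a b)
    rw [intervalIntegral.integral_neg] at this
    congr 1
    linarith
  -- The tail is known only strictly below `L`, where `ρ` may have an atom; the open interval is
  -- exhausted by intervals ending before `L`.
  have key : ∀ L' : ℝ, L' < L → ρ.restrict (Ioc 0 L') = ν.restrict (Ioc 0 L') := by
    intro L' hL'
    refine Measure.ext_of_Ioc_finite _ _ ?_ ?_ 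
    · simp only [Measure.restrict_apply_univ]
      rcases le_or_gt 0 L' with h | h
      · exact hIoc 0 L' le_rfl h hL'
      · rw [Ioc_eq_empty (not_lt.2 h.le)]; simp
    · intro a b hab
      rw [Measure.restrict_apply measurableSet_Ioc, Measure.restrict_apply measurableSet_Ioc,
        Ioc_inter_Ioc]
      rcases le_or_gt (a ⊔ 0) (b ⊓ L') with h | h
      · exact hIoc _ _ le_sup_right h (inf_le_right.trans_lt hL')
      · rw [Ioc_eq_empty (not_lt.2 h.le)]; simp
  have hU : Ioo 0 L ⊆ ⋃ n : ℕ, Ioc 0 (L - 1 / ((n : ℝ) + 1)) := by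
    intro x hx
    obtain ⟨n, hn⟩ := exists_nat_one_div_lt (sub_pos.2 hx.2)
    exact mem_iUnion.2 ⟨n, hx.1, by linarith⟩
  have hr : ρ.restrict (⋃ n : ℕ, Ioc 0 (L - 1 / ((n : ℝ) + 1))) =
      ν.restrict (⋃ n : ℕ, Ioc 0 (L - 1 / ((n : ℝ) + 1))) :=
    Measure.restrict_iUnion_congr.2 fun n => key _ (by
      have : (0 : ℝ) < 1 / ((n : ℝ) + 1) := by positivity
      linarith)
  rw [← withDensity_apply _ hB, ← Measure.restrict_eq_self ρ (hBL.trans hU), hr,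
    Measure.restrict_eq_self _ (hBL.trans hU)]

/-! ### Interarrival sequences and conditioning on the first arrival -/

/-- The sequence of interarrival times after the first arrival. -/
def seqShift (x : ℕ → ℝ) : ℕ → ℝ := fun n => x (n + 1)

/-- Prepend an interarrival time. -/
def seqCons (s : ℝ) (y : ℕ → ℝ) : ℕ → ℝ
  | 0 => s
  | n + 1 => y n

@[simp] lemma seqShift_seqCons (s : ℝ) (y : ℕ → ℝ) : seqShift (seqCons s y) = y := rfl

@[simp] lemma seqCons_zero (s : ℝ) (y : ℕ → ℝ) : seqCons s y 0 = s := rfl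

@[fun_prop] lemma measurable_seqShift : Measurable seqShift :=
  measurable_pi_lambda _ fun n => measurable_pi_apply (n + 1)

lemma measurable_seqCons : Measurable fun p : ℝ × (ℕ → ℝ) => seqCons p.1 p.2 := by
  refine measurable_pi_lambda _ fun n => ?_
  cases n with
  | zero => exact measurable_fst
  | succ n => exact (measurable_pi_apply n).comp measurable_snd

/-- The law of the interarrival times of a Poisson process of rate `lam`. -/
def interarrivalLaw (lam : ℝ) : Measure (ℕ → ℝ) := Measure.infinitePi fun _ => expMeasure lam

lemma isProbabilityMeasure_interarrivalLaw {lam : ℝ} (hlam : 0 < lam) :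
    IsProbabilityMeasure (interarrivalLaw lam) := by
  have := isProbabilityMeasure_expMeasure hlam
  unfold interarrivalLaw
  infer_instance

/-- A product measure is determined by finite cylinders, and the preimage of a cylinder is a
rectangle. This is the renewal property behind the first-arrival recursion. -/
lemma map_seqCons_interarrivalLaw {lam : ℝ} (hlam : 0 < lam) :
    ((expMeasure lam).prod (interarrivalLaw lam)).map (fun p => seqCons p.1 p.2) =
      interarrivalLaw lam := by
  have := isProbabilityMeasure_expMeasure hlam
  have := isProbabilityMeasure_interarrivalLaw hlam
  refine Measure.eq_infinitePi _ fun s u hu => ?_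
  rw [Measure.map_apply measurable_seqCons (.pi s.countable_toSet fun i _ => hu i)]
  have hpre : (fun p : ℝ × (ℕ → ℝ) => seqCons p.1 p.2) ⁻¹' Set.pi (s : Set ℕ) u =
      (if 0 ∈ s then u 0 else univ) ×ˢ
        Set.pi ((s.preimage (· + 1) (add_left_injective 1).injOn : Finset ℕ) : Set ℕ)
          (fun n => u (n + 1)) := by
    ext ⟨a, y⟩
    simp only [mem_preimage, Set.mem_pi, mem_prod, Finset.mem_coe, Finset.mem_preimage]
    constructor
    · intro h
      refine ⟨?_, fun n hn => h (n + 1) hn⟩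
      split_ifs with h0
      · exact h 0 h0
      · trivial
    · rintro ⟨h0, h1⟩ n hn
      cases n with
      | zero => simpa [hn] using h0
      | succ n => exact h1 n hn
  rw [hpre, Measure.prod_prod, interarrivalLaw, Measure.infinitePi_pi _ fun i _ => hu (i + 1)]
  have hu0 : (expMeasure lam) (if 0 ∈ s then u 0 else univ) =
      if 0 ∈ s then expMeasure lam (u 0) else 1 := by
    split_ifs <;> simp
  have himg : (s.preimage (· + 1) (add_left_injective 1).injOn).image (· + 1) = s.erase 0 := by
    ext n
    cases n <;> simp
  rw [hu0]
  have hprod : ∏ i ∈ s.preimage (· + 1) (add_left_injective 1).injOn, expMeasure lam (u (i + 1)) =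
      ∏ i ∈ s.erase 0, expMeasure lam (u i) := by
    rw [← himg, Finset.prod_image (add_left_injective 1).injOn]
  rw [hprod]
  split_ifs with h0
  · exact Finset.mul_prod_erase s (fun i => expMeasure lam (u i)) h0
  · rw [one_mul, Finset.erase_eq_of_notMem h0]

lemma measure_interarrivalLaw_lt {lam t : ℝ} (hlam : 0 < lam) (ht : 0 ≤ t) :
    interarrivalLaw lam {x | t < x 0} = ENNReal.ofReal (Real.exp (-lam * t)) := by
  have := isProbabilityMeasure_expMeasure hlam
  have h : interarrivalLaw lam {x | t < x 0} = expMeasure lam (Ioi t) := by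
    rw [← Measure.infinitePi_map_eval (fun _ : ℕ => expMeasure lam) 0,
      Measure.map_apply (measurable_pi_apply 0) measurableSet_Ioi]
    rfl
  rw [h, ← compl_Iic, prob_compl_eq_one_sub measurableSet_Iic, ← ofReal_cdf,
    cdf_expMeasure_eq hlam, if_pos ht, ← ENNReal.ofReal_one, ← ENNReal.ofReal_sub]
  · congr 1; rw [neg_mul]; ring
  · rw [sub_nonneg]; exact Real.exp_le_one_iff.2 (by nlinarith)

/-- The weight `exp (-lam t) lam ^ n a` of a configuration set of volume `a` with `n` arrivals. -/
def poissonWeight (lam : ℝ) (n : ℕ) (t a : ℝ) : ℝ≥0∞ :=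
  ENNReal.ofReal (Real.exp (-lam * t) * lam ^ n * a)

@[simp] lemma poissonWeight_zero_right (lam : ℝ) (n : ℕ) (t : ℝ) : poissonWeight lam n t 0 = 0 := by
  simp [poissonWeight]

/-- The exponentials `exp (-(lam * s))` and `exp (-lam * (t - s))` multiply to a constant in `s`, so
only the volumes are integrated. -/
lemma setLIntegral_poissonWeight {lam t r r' : ℝ} (hlam : 0 < lam) (hr : r ≤ r') (n : ℕ)
    {g G : ℝ → ℝ} (hG : ∀ s, HasDerivAt G (g s) s) (hg : Continuous g)
    (hg0 : ∀ s ∈ Ioo r r', 0 ≤ g s) :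
    ∫⁻ s in Ioo r r', ENNReal.ofReal (lam * Real.exp (-(lam * s))) * poissonWeight lam n (t - s)
        (g s)
      = poissonWeight lam (n + 1) t (G r' - G r) := by
  have h1 : ∀ s, ENNReal.ofReal (lam * Real.exp (-(lam * s))) * poissonWeight lam n (t - s) (g s) =
      ENNReal.ofReal (Real.exp (-lam * t) * lam ^ (n + 1) * g s) := by
    intro s
    rw [poissonWeight, ← ENNReal.ofReal_mul (by positivity)]
    congr 1
    rw [show -lam * t = -(lam * s) + -lam * (t - s) by ring, Real.exp_add]
    ring
  simp_rw [h1]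
  rw [Measure.restrict_congr_set Ioo_ae_eq_Ioc,
    ← ofReal_integral_eq_lintegral_ofReal, ← intervalIntegral.integral_of_le hr,
    intervalIntegral.integral_const_mul,
    intervalIntegral.integral_eq_sub_of_hasDerivAt (fun x _ => hG x) (hg.intervalIntegrable _ _)]
  · rfl
  · exact (hg.const_mul _).integrableOn_Ioc
  · rw [← Measure.restrict_congr_set Ioo_ae_eq_Ioc]
    refine (ae_restrict_iff' measurableSet_Ioo).2 (.of_forall fun s hs => ?_)
    have := hg0 s hs
    simp only [Pi.zero_apply]
    positivity

/-- Conditioning on the first arrival. -/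
lemma interarrivalLaw_first_step {lam t r : ℝ} (hlam : 0 < lam) (hr : 0 ≤ r) (hrt : r ≤ t) {n : ℕ}
    {E : Set (ℝ × (ℕ → ℝ))} (hE : MeasurableSet E) {g₁ g₂ G₁ G₂ : ℝ → ℝ}
    (hG₁ : ∀ s, HasDerivAt G₁ (g₁ s) s) (hG₂ : ∀ s, HasDerivAt G₂ (g₂ s) s)
    (hg₁ : Continuous g₁) (hg₂ : Continuous g₂)
    (hp₁ : ∀ s ∈ Ioo 0 r, 0 ≤ g₁ s) (hp₂ : ∀ s ∈ Ioo r t, 0 ≤ g₂ s)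
    (h₁ : ∀ s ∈ Ioo 0 r, interarrivalLaw lam {y | (s, y) ∈ E} = poissonWeight lam n (t - s) (g₁ s))
    (h₂ : ∀ s ∈ Ioo r t, interarrivalLaw lam {y | (s, y) ∈ E} = poissonWeight lam n (t - s)
        (g₂ s)) :
    interarrivalLaw lam {x | x 0 ≤ t ∧ (x 0, seqShift x) ∈ E} =
      poissonWeight lam (n + 1) t ((G₁ r - G₁ 0) + (G₂ t - G₂ r)) := by
  have := isProbabilityMeasure_expMeasure hlam
  have := isProbabilityMeasure_interarrivalLaw hlam
  have hmono : ∀ {G g : ℝ → ℝ} {a b : ℝ}, a ≤ b → (∀ s, HasDerivAt G (g s) s) → Continuous g →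
      (∀ s ∈ Ioo a b, 0 ≤ g s) → 0 ≤ G b - G a := by
    intro G g a b hab hG hg hp
    rw [← intervalIntegral.integral_eq_sub_of_hasDerivAt (fun x _ => hG x)
      (hg.intervalIntegrable a b), intervalIntegral.integral_of_le hab,
      ← Measure.restrict_congr_set Ioo_ae_eq_Ioc]
    exact setIntegral_nonneg measurableSet_Ioo hp
  have hS : MeasurableSet {x : ℕ → ℝ | x 0 ≤ t ∧ (x 0, seqShift x) ∈ E} :=
    (measurableSet_le (measurable_pi_apply 0) measurable_const).inter
      (((measurable_pi_apply 0).prodMk measurable_seqShift) hE)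
  have hm : Measurable fun s => interarrivalLaw lam {y | (s, y) ∈ E} :=
    measurable_measure_prodMk_left hE
  conv_lhs => rw [← map_seqCons_interarrivalLaw hlam]
  rw [Measure.map_apply measurable_seqCons hS, Measure.prod_apply (measurable_seqCons hS)]
  have hsec : ∀ s, interarrivalLaw lam (Prod.mk s ⁻¹' ((fun p : ℝ × (ℕ → ℝ) => seqCons p.1 p.2) ⁻¹'
      {x : ℕ → ℝ | x 0 ≤ t ∧ (x 0, seqShift x) ∈ E})) =
      (Iic t).indicator (fun s => interarrivalLaw lam {y | (s, y) ∈ E}) s := by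
    intro s
    by_cases hs : s ≤ t
    · simp [hs]
    · simp [hs]
  simp_rw [hsec]
  have hpdf : expMeasure lam = volume.withDensity (exponentialPDF lam) := rfl
  rw [hpdf, lintegral_withDensity_eq_lintegral_mul _ (by unfold exponentialPDF; fun_prop)
    (hm.indicator measurableSet_Iic)]
  rw [poissonWeight, mul_add, ENNReal.ofReal_add
    (mul_nonneg (by positivity) (hmono hr hG₁ hg₁ hp₁))
    (mul_nonneg (by positivity) (hmono hrt hG₂ hg₂ hp₂)),
    ← poissonWeight, ← poissonWeight, ← setLIntegral_poissonWeight hlam hr n hG₁ hg₁ hp₁,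
    ← setLIntegral_poissonWeight hlam hrt n hG₂ hg₂ hp₂,
    ← lintegral_indicator measurableSet_Ioo, ← lintegral_indicator measurableSet_Ioo,
    ← lintegral_add_left ?_]
  · refine lintegral_congr_ae ?_
    -- The section formulas are assumed on open intervals only; their endpoints are discarded as a
    -- null set.
    have hnull : ∀ᵐ s : ℝ, s ∉ ({0, r, t} : Set ℝ) :=
      measure_eq_zero_iff_ae_notMem.1 ((Set.toFinite _).measure_zero _)
    filter_upwards [hnull] with s hs
    simp only [mem_insert_iff, mem_singleton_iff, not_or] at hs
    obtain ⟨hs0, hsr, hst⟩ := hs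
    simp only [Pi.mul_apply]
    rcases lt_or_gt_of_ne hs0 with h0 | h0
    · simp [indicator_apply, exponentialPDF_of_neg h0, not_lt.2 h0.le,
        not_lt.2 (h0.trans_le hr).le]
    · rw [exponentialPDF_of_nonneg h0.le]
      rcases lt_or_gt_of_ne hsr with h1 | h1
      · simp [h0, h1, not_lt.2 h1.le, (h1.trans_le hrt).le, h₁ s ⟨h0, h1⟩]
      · rcases lt_or_gt_of_ne hst with h2 | h2
        · simp [h1, h2, not_lt.2 h1.le, h2.le, h₂ s ⟨h1, h2⟩]
        · simp [h2, not_lt.2 h1.le, not_lt.2 h2.le]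
  · refine Measurable.indicator ?_ measurableSet_Ioo
    unfold poissonWeight
    have := hg₁.measurable
    fun_prop

/-! ### Position and maximum for a fixed number of reversals -/

/-- Exactly `n` arrivals take place in `[0, t]`. -/
def HasCount : ℕ → ℝ → (ℕ → ℝ) → Prop
  | 0, t, x => t < x 0
  | n + 1, t, x => x 0 ≤ t ∧ HasCount n (t - x 0) (seqShift x)

/-- The position at time `t` of the unit speed telegraph process started upwards, if there are
`n` reversals in `[0, t]`. -/
def pathEnd : ℕ → ℝ → (ℕ → ℝ) → ℝ
  | 0, t, _ => t
  | n + 1, t, x => x 0 - pathEnd n (t - x 0) (seqShift x)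

/-- The maxima over `[0, t]` of the unit speed telegraph process started upwards and of the one
started downwards, if there are `n` reversals in `[0, t]`. -/
def pathMax : ℕ → ℝ → (ℕ → ℝ) → ℝ × ℝ
  | 0, t, _ => (t, 0)
  | n + 1, t, x => (x 0 + (pathMax n (t - x 0) (seqShift x)).2,
      max 0 ((pathMax n (t - x 0) (seqShift x)).1 - x 0))

lemma measurable_step :
    Measurable fun p : ℝ × (ℕ → ℝ) => (p.1 - p.2 0, seqShift p.2) := by fun_prop

lemma measurable_pathEnd (n : ℕ) : Measurable fun p : ℝ × (ℕ → ℝ) => pathEnd n p.1 p.2 := by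
  induction n with
  | zero => exact measurable_fst
  | succ n ih => exact ((measurable_pi_apply 0).comp measurable_snd).sub (ih.comp measurable_step)

lemma measurable_pathMax (n : ℕ) : Measurable fun p : ℝ × (ℕ → ℝ) => pathMax n p.1 p.2 := by
  induction n with
  | zero => exact measurable_fst.prodMk measurable_const
  | succ n ih =>
    have h0 : Measurable fun p : ℝ × (ℕ → ℝ) => p.2 0 :=
      (measurable_pi_apply 0).comp measurable_snd
    exact (h0.add (ih.comp measurable_step).snd).prodMk
      (measurable_const.max ((ih.comp measurable_step).fst.sub h0))

lemma measurableSet_hasCount (n : ℕ) :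
    MeasurableSet {p : ℝ × (ℕ → ℝ) | HasCount n p.1 p.2} := by
  have h0 : Measurable fun p : ℝ × (ℕ → ℝ) => p.2 0 := (measurable_pi_apply 0).comp measurable_snd
  induction n with
  | zero => exact measurableSet_lt measurable_fst h0
  | succ n ih => exact (measurableSet_le h0 measurable_fst).inter (measurable_step ih)

lemma pathMax_snd_nonneg (n : ℕ) (t : ℝ) (x : ℕ → ℝ) : 0 ≤ (pathMax n t x).2 := by
  cases n with
  | zero => exact le_rfl
  | succ n => exact le_max_left _ _

lemma measurable_time_sub (t : ℝ) : Measurable fun p : ℝ × (ℕ → ℝ) => (t - p.1, p.2) := by fun_prop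

lemma hasDerivAt_sub_pow_div_factorial (n : ℕ) (t s : ℝ) :
    HasDerivAt (fun s => -((t - s) ^ (n + 1) / ((n + 1).factorial : ℝ)))
      ((t - s) ^ n / (n.factorial : ℝ)) s :=
  (hasDerivAt_pow_div_factorial ((hasDerivAt_id s).const_sub t) n).neg.congr_deriv
    (by simp only [id_eq]; ring)

lemma interarrivalLaw_hasCount {lam : ℝ} (hlam : 0 < lam) (n : ℕ) : ∀ {t : ℝ}, 0 < t →
    interarrivalLaw lam {x | HasCount n t x} =
      poissonWeight lam n t (t ^ n / (n.factorial : ℝ)) := by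
  induction n with
  | zero =>
    intro t ht
    simpa [poissonWeight, HasCount] using measure_interarrivalLaw_lt hlam ht.le
  | succ n ih =>
    intro t ht
    -- With `r = 0` the first of the two pieces is empty.
    refine (interarrivalLaw_first_step (n := n) hlam le_rfl ht.le
      (measurable_time_sub t (measurableSet_hasCount n)) (g₁ := fun _ => 0) (G₁ := fun _ => 0)
      (fun s => hasDerivAt_const s 0) (hasDerivAt_sub_pow_div_factorial n t) continuous_const
      (by fun_prop) (by simp) (fun s hs => ?_) (by simp) (fun s hs => ih (sub_pos.2 hs.2))).trans ?_
    · have := sub_pos.2 hs.2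
      positivity
    · simp

lemma hasDerivAt_truncBinom_shift_left (n : ℕ) (k : ℤ) (p q s : ℝ) :
    HasDerivAt (fun s => -truncBinom (n + 1) k (p - s) q) (truncBinom n (k + 1) (p - s) q) s :=
  (hasDerivAt_truncBinom_succ ((hasDerivAt_id s).const_sub p)
      (hasDerivAt_const s q) n k).neg.congr_deriv
    (by simp)

lemma hasDerivAt_truncBinom_shift_right (n : ℕ) (k : ℤ) (p q s : ℝ) :
    HasDerivAt (fun s => -truncBinom (n + 1) k p (q - s)) (truncBinom n (k - 1) p (q - s)) s :=
  (hasDerivAt_truncBinom_succ (hasDerivAt_const s p)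
      ((hasDerivAt_id s).const_sub q) n k).neg.congr_deriv
    (by simp)

/-- The joint law of the position at time `t` and of the number of reversals. -/
lemma interarrivalLaw_pathEnd {lam : ℝ} (hlam : 0 < lam) (n : ℕ) : ∀ {t : ℝ}, 0 < t → ∀ b : ℝ,
    (interarrivalLaw lam {x | HasCount n t x ∧ b < pathEnd n t x} = poissonWeight lam n t
      (if b < -t then t ^ n / (n.factorial : ℝ) else if b < t then
        truncBinom n 0 ((t + b) / 2) ((t - b) / 2) else 0)) ∧
    (interarrivalLaw lam {x | HasCount n t x ∧ b < -pathEnd n t x} = poissonWeight lam n t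
      (if b < -t then t ^ n / (n.factorial : ℝ) else if b < t then
        truncBinom n 1 ((t + b) / 2) ((t - b) / 2) else 0)) := by
  induction n with
  | zero =>
    intro t ht b
    have h := interarrivalLaw_hasCount hlam 0 ht
    simp only [HasCount, pow_zero, Nat.factorial_zero, Nat.cast_one, div_one] at h
    have h0 : ∀ p q, truncBinom 0 0 p q = 1 := by intro p q; simp [truncBinom]
    have h1 : ∀ p q, truncBinom 0 1 p q = 0 := by intro p q; simp [truncBinom]
    simp only [HasCount, pathEnd, h0, h1, pow_zero, Nat.factorial_zero, Nat.cast_one, div_one]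
    constructor
    · by_cases hb : b < t
      · simp [hb, h]
      · have : ¬ b < -t := by linarith
        simp [hb, this]
    · by_cases hb : b < -t
      · simp [hb, h]
      · simp [hb]
  | succ n ih =>
    intro t ht b
    have hEm : ∀ f : ℝ × (ℕ → ℝ) → ℝ, Measurable f → MeasurableSet
        {p : ℝ × (ℕ → ℝ) | HasCount n (t - p.1) p.2 ∧ b < f p} := fun f hf =>
      (measurable_time_sub t (measurableSet_hasCount n)).inter
          (measurableSet_lt measurable_const hf)
    have hm : Measurable fun p : ℝ × (ℕ → ℝ) => pathEnd n (t - p.1) p.2 :=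
      (measurable_pathEnd n).comp (measurable_time_sub t)
    have hEp := hEm (fun p => p.1 - pathEnd n (t - p.1) p.2) (measurable_fst.sub hm)
    have hEn := hEm (fun p => -(p.1 - pathEnd n (t - p.1) p.2)) (measurable_fst.sub hm).neg
    have hsetp : {x | HasCount (n + 1) t x ∧ b < pathEnd (n + 1) t x} = {x | x 0 ≤ t ∧
        (x 0, seqShift x) ∈ {p : ℝ × (ℕ → ℝ) | HasCount n (t - p.1) p.2 ∧
          b < p.1 - pathEnd n (t - p.1) p.2}} := by
      ext x; simp only [HasCount, pathEnd, mem_ofPred_eq, and_assoc]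
    have hsetn : {x | HasCount (n + 1) t x ∧ b < -pathEnd (n + 1) t x} = {x | x 0 ≤ t ∧
        (x 0, seqShift x) ∈ {p : ℝ × (ℕ → ℝ) | HasCount n (t - p.1) p.2 ∧
          b < -(p.1 - pathEnd n (t - p.1) p.2)}} := by
      ext x; simp only [HasCount, pathEnd, mem_ofPred_eq, and_assoc]
    have hsecp : ∀ s ∈ Ioo 0 t, interarrivalLaw lam {y | (s, y) ∈
        {p : ℝ × (ℕ → ℝ) | HasCount n (t - p.1) p.2 ∧ b < p.1 - pathEnd n (t - p.1) p.2}} =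
        poissonWeight lam n (t - s) (if b - s < -(t - s) then (t - s) ^ n / (n.factorial : ℝ) else
          if b - s < t - s then
            truncBinom n 1 ((t - s + (b - s)) / 2) ((t - s - (b - s)) / 2) else 0) := by
      intro s hs
      rw [← (ih (sub_pos.2 hs.2) (b - s)).2]
      congr 1
      ext y
      simp only [mem_ofPred_eq]
      exact and_congr_right fun _ => by constructor <;> intro h <;> linarith
    have hsecn : ∀ s ∈ Ioo 0 t, interarrivalLaw lam {y | (s, y) ∈
        {p : ℝ × (ℕ → ℝ) | HasCount n (t - p.1) p.2 ∧ b < -(p.1 - pathEnd n (t - p.1) p.2)}} =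
        poissonWeight lam n (t - s) (if b + s < -(t - s) then (t - s) ^ n / (n.factorial : ℝ) else
          if b + s < t - s then
            truncBinom n 0 ((t - s + (b + s)) / 2) ((t - s - (b + s)) / 2) else 0) := by
      intro s hs
      rw [← (ih (sub_pos.2 hs.2) (b + s)).1]
      congr 1
      ext y
      simp only [mem_ofPred_eq]
      exact and_congr_right fun _ => by constructor <;> intro h <;> linarith
    have hpow : ∀ s ∈ Ioo 0 t, 0 ≤ (t - s) ^ n / (n.factorial : ℝ) := fun s hs => by
      have := sub_pos.2 hs.2
      positivity
    rw [hsetp, hsetn]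
    rcases lt_or_ge b (-t) with hb | hb
    · rw [if_pos hb, if_pos hb]
      constructor
      · refine (interarrivalLaw_first_step (n := n) hlam le_rfl ht.le hEp (g₁ := fun _ => 0)
          (G₁ := fun _ => 0) (fun s => hasDerivAt_const s 0) (hasDerivAt_sub_pow_div_factorial n t)
          continuous_const (by fun_prop) (by simp) hpow (by simp) fun s hs => ?_).trans (by simp)
        rw [hsecp s hs, if_pos (by linarith [hs.1])]
      · refine (interarrivalLaw_first_step (n := n) hlam le_rfl ht.le hEn (g₁ := fun _ => 0)
          (G₁ := fun _ => 0) (fun s => hasDerivAt_const s 0) (hasDerivAt_sub_pow_div_factorial n t)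
          continuous_const (by fun_prop) (by simp) hpow (by simp) fun s hs => ?_).trans (by simp)
        rw [hsecn s hs, if_pos (by linarith [hs.1])]
    rw [if_neg hb.not_gt, if_neg hb.not_gt]
    rcases lt_or_ge b t with hbt | hbt
    · rw [if_pos hbt, if_pos hbt]
      constructor
      -- A path reversing first after time `(t + b) / 2` ends above `b` even if it then descends
      -- throughout. An earlier reversal at `s` replaces `(p, q)` by `(p - s, q)`.
      · refine (interarrivalLaw_first_step (n := n) hlam (r := (t + b) / 2) (by linarith)
          (by linarith) hEp
          (hasDerivAt_truncBinom_shift_left n 0 ((t + b) / 2) ((t - b) / 2))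
          (hasDerivAt_sub_pow_div_factorial n t)
          (continuous_truncBinom _ _ (by fun_prop) (by fun_prop)) (by fun_prop)
          (fun s hs => truncBinom_nonneg _ _ (by linarith [hs.2]) (by linarith))
          (fun s hs => hpow s ⟨by linarith [hs.1], hs.2⟩) (fun s hs => ?_) fun s hs => ?_).trans ?_
        · rw [hsecp s ⟨hs.1, by linarith [hs.2]⟩, if_neg (by linarith [hs.2]),
            if_pos (by linarith)]
          norm_num
          congr 2
          all_goals ring
        · rw [hsecp s ⟨by linarith [hs.1], hs.2⟩, if_pos (by linarith [hs.1])]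
        -- The boundary value at `p - s = 0` is `q ^ (n + 1) / (n + 1)!`, which cancels the
        -- contribution of the certain piece.
        · congr 1
          rw [sub_self, truncBinom_zero_left_zero, sub_zero,
            show t - (t + b) / 2 = (t - b) / 2 by ring]
          simp
      -- A path that climbs for time `(t - b) / 2` or more can no longer end below `-b`. An earlier
      -- reversal at `s` replaces `(p, q)` by `(p, q - s)`.
      · refine (interarrivalLaw_first_step (n := n) hlam (r := (t - b) / 2) (by linarith)
          (by linarith) hEn
          (hasDerivAt_truncBinom_shift_right n 1 ((t + b) / 2) ((t - b) / 2))
          (fun s => hasDerivAt_const s 0)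
          (continuous_truncBinom _ _ (by fun_prop) (by fun_prop)) continuous_const
          (fun s hs => truncBinom_nonneg _ _ (by linarith) (by linarith [hs.2]))
          (by simp) (fun s hs => ?_) fun s hs => ?_).trans ?_
        · rw [hsecn s ⟨hs.1, by linarith [hs.2]⟩, if_neg (by linarith [hs.2]),
            if_pos (by linarith [hs.2])]
          norm_num
          congr 2
          all_goals ring
        · rw [hsecn s ⟨by linarith [hs.1], hs.2⟩, if_neg (by linarith [hs.1]),
            if_neg (by linarith [hs.1])]
        · congr 1
          rw [sub_self, truncBinom_succ_right_zero n (by norm_num), sub_zero]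
          simp
    · rw [if_neg hbt.not_gt, if_neg hbt.not_gt]
      constructor
      · refine (interarrivalLaw_first_step (n := n) hlam le_rfl ht.le hEp
          (fun s => hasDerivAt_const s 0) (fun s => hasDerivAt_const s 0)
          continuous_const continuous_const (by simp) (by simp) (by simp)
            fun s hs => ?_).trans (by simp)
        rw [hsecp s hs, if_neg (by linarith [hs.2]), if_neg (by linarith)]
      · refine (interarrivalLaw_first_step (n := n) hlam le_rfl ht.le hEn
          (fun s => hasDerivAt_const s 0) (fun s => hasDerivAt_const s 0)
          continuous_const continuous_const (by simp) (by simp) (by simp)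
            fun s hs => ?_).trans (by simp)
        rw [hsecn s hs, if_neg (by linarith [hs.1, hs.2]), if_neg (by linarith [hs.1])]

/-- The joint law of the maximum over `[0, t]` and of the number of reversals. -/
lemma interarrivalLaw_pathMax {lam : ℝ} (hlam : 0 < lam) (n : ℕ) : ∀ {t : ℝ}, 0 < t → ∀ b : ℝ,
    (0 ≤ b → interarrivalLaw lam {x | HasCount n t x ∧ b < (pathMax n t x).1} =
      poissonWeight lam n t (if b < t then maxTail n t b else 0)) ∧
    (interarrivalLaw lam {x | HasCount n t x ∧ b < (pathMax n t x).2} = poissonWeight lam n t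
      (if b < 0 then t ^ n / (n.factorial : ℝ) else if b < t then
        truncBinom n 1 ((t + b) / 2) ((t - b) / 2) + truncBinom n 2 ((t + b) / 2) ((t - b) / 2)
        else 0)) := by
  induction n with
  | zero =>
    intro t ht b
    have h := interarrivalLaw_hasCount hlam 0 ht
    simp only [HasCount, pow_zero, Nat.factorial_zero, Nat.cast_one, div_one] at h
    have h0 : ∀ p q, truncBinom 0 0 p q = 1 := by intro p q; simp [truncBinom]
    have h1 : ∀ p q, truncBinom 0 1 p q = 0 := by intro p q; simp [truncBinom]
    have h2 : ∀ p q, truncBinom 0 2 p q = 0 := by intro p q; simp [truncBinom]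
    simp only [HasCount, pathMax, maxTail, h0, h1, h2, pow_zero, Nat.factorial_zero, Nat.cast_one,
      div_one, add_zero, ite_self]
    constructor
    · intro _
      by_cases hb : b < t
      · simp [hb, h]
      · simp [hb]
    · by_cases hb : b < 0
      · simp [hb, h]
      · simp [hb]
  | succ n ih =>
    intro t ht b
    have hEm : ∀ f : ℝ × (ℕ → ℝ) → ℝ, Measurable f → MeasurableSet
        {p : ℝ × (ℕ → ℝ) | HasCount n (t - p.1) p.2 ∧ b < f p} := fun f hf =>
      (measurable_time_sub t (measurableSet_hasCount n)).inter
          (measurableSet_lt measurable_const hf)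
    have hm : Measurable fun p : ℝ × (ℕ → ℝ) => pathMax n (t - p.1) p.2 :=
      (measurable_pathMax n).comp (measurable_time_sub t)
    have hEp := hEm (fun p => p.1 + (pathMax n (t - p.1) p.2).2) (measurable_fst.add hm.snd)
    have hEn := hEm (fun p => (pathMax n (t - p.1) p.2).1 - p.1) (hm.fst.sub measurable_fst)
    have hsetp : {x | HasCount (n + 1) t x ∧ b < (pathMax (n + 1) t x).1} = {x | x 0 ≤ t ∧
        (x 0, seqShift x) ∈ {p : ℝ × (ℕ → ℝ) | HasCount n (t - p.1) p.2 ∧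
          b < p.1 + (pathMax n (t - p.1) p.2).2}} := by
      ext x; simp only [HasCount, pathMax, mem_ofPred_eq, and_assoc]
    have hpow : ∀ s ∈ Ioo 0 t, 0 ≤ (t - s) ^ n / (n.factorial : ℝ) := fun s hs => by
      have := sub_pos.2 hs.2
      positivity
    have hsecp : ∀ s ∈ Ioo 0 t, interarrivalLaw lam {y | (s, y) ∈
        {p : ℝ × (ℕ → ℝ) | HasCount n (t - p.1) p.2 ∧ b < p.1 + (pathMax n (t - p.1) p.2).2}} =
        poissonWeight lam n (t - s) (if b - s < 0 then (t - s) ^ n / (n.factorial : ℝ) else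
          if b - s < t - s then truncBinom n 1 ((t - s + (b - s)) / 2) ((t - s - (b - s)) / 2) +
            truncBinom n 2 ((t - s + (b - s)) / 2) ((t - s - (b - s)) / 2) else 0) := by
      intro s hs
      rw [← (ih (sub_pos.2 hs.2) (b - s)).2]
      congr 1
      ext y
      simp only [mem_ofPred_eq]
      exact and_congr_right fun _ => by constructor <;> intro h <;> linarith
    constructor
    · intro hb
      rw [hsetp]
      rcases lt_or_ge b t with hbt | hbt
      · rw [if_pos hbt]
        -- A first reversal after time `b` means that the level has already been passed. Otherwise a
        -- path started downwards must climb by `b - s`, with `(p, q)` replaced by `(p - s, q)`.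
        refine (interarrivalLaw_first_step (n := n) hlam (r := b) hb hbt.le hEp
          (fun s => (hasDerivAt_truncBinom_shift_left n 0 ((t + b) / 2) ((t - b) / 2) s).add
            (hasDerivAt_truncBinom_shift_left n 1 ((t + b) / 2) ((t - b) / 2) s))
          (hasDerivAt_sub_pow_div_factorial n t)
          ((continuous_truncBinom _ _ (by fun_prop) (by fun_prop)).add
            (continuous_truncBinom _ _ (by fun_prop) (by fun_prop))) (by fun_prop)
          (fun s hs => add_nonneg
            (truncBinom_nonneg _ _ (by linarith [hs.2]) (by linarith))
            (truncBinom_nonneg _ _ (by linarith [hs.2]) (by linarith)))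
          (fun s hs => hpow s ⟨by linarith [hs.1], hs.2⟩) (fun s hs => ?_) fun s hs => ?_).trans ?_
        · rw [hsecp s ⟨hs.1, by linarith [hs.2]⟩, if_neg (by linarith [hs.2]),
            if_pos (by linarith), show (t - s + (b - s)) / 2 = (t + b) / 2 - s by ring,
            show (t - s - (b - s)) / 2 = (t - b) / 2 by ring]
          norm_num
        · rw [hsecp s ⟨by linarith [hs.1], hs.2⟩, if_pos (by linarith [hs.1])]
        · congr 1
          -- At `s = b` both arguments equal `q`, so the boundary term is a full binomial sum. It
          -- equals the volume `(t - b) ^ (n + 1) / (n + 1)!` of the certain piece and cancels it.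
          have h := truncBinom_add_truncBinom_self (n + 1) ((t - b) / 2)
          rw [show 2 * ((t - b) / 2) = t - b by ring] at h
          simp only [Pi.add_apply, sub_zero, sub_self, ne_eq, Nat.add_eq_zero_iff, one_ne_zero,
            and_false, not_false_eq_true, zero_pow, zero_div, neg_zero, maxTail]
          rw [show (t + b) / 2 - b = (t - b) / 2 by ring]
          linarith
      · rw [if_neg hbt.not_gt]
        refine (interarrivalLaw_first_step (n := n) hlam le_rfl ht.le hEp
          (fun s => hasDerivAt_const s 0) (fun s => hasDerivAt_const s 0)
          continuous_const continuous_const (by simp) (by simp) (by simp)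
            fun s hs => ?_).trans (by simp)
        rw [hsecp s hs, if_neg (by linarith [hs.2]), if_neg (by linarith)]
    · rcases lt_or_ge b 0 with hb | hb
      · rw [if_pos hb, ← interarrivalLaw_hasCount hlam (n + 1) ht]
        congr 1
        ext x
        simp only [mem_ofPred_eq, and_iff_left_iff_imp]
        exact fun _ => hb.trans_le (pathMax_snd_nonneg _ _ _)
      have hsetn : {x | HasCount (n + 1) t x ∧ b < (pathMax (n + 1) t x).2} = {x | x 0 ≤ t ∧
          (x 0, seqShift x) ∈ {p : ℝ × (ℕ → ℝ) | HasCount n (t - p.1) p.2 ∧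
            b < (pathMax n (t - p.1) p.2).1 - p.1}} := by
        ext x
        simp only [HasCount, pathMax, mem_ofPred_eq, and_assoc, lt_max_iff, hb.not_gt, false_or]
      have hsecn : ∀ s ∈ Ioo 0 t, interarrivalLaw lam {y | (s, y) ∈
          {p : ℝ × (ℕ → ℝ) | HasCount n (t - p.1) p.2 ∧ b < (pathMax n (t - p.1) p.2).1 - p.1}} =
          poissonWeight lam n (t - s) (if b + s < t - s then maxTail n (t - s) (b + s) else 0) := by
        intro s hs
        rw [← (ih (sub_pos.2 hs.2) (b + s)).1 (by linarith [hs.1])]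
        congr 1
        ext y
        simp only [mem_ofPred_eq]
        exact and_congr_right fun _ => by constructor <;> intro h <;> linarith
      rw [hsetn, if_neg hb.not_gt]
      rcases lt_or_ge b t with hbt | hbt
      · rw [if_pos hbt]
        -- After descending for time `s`, the path must climb by `b + s` in the remaining time `t -
        -- s`, which is impossible once `s ≥ (t - b) / 2`. The boundary terms vanish since `q - s =
        -- 0` there.
        refine (interarrivalLaw_first_step (n := n) hlam (r := (t - b) / 2) (by linarith)
            (by linarith) hEn
          (fun s => (hasDerivAt_truncBinom_shift_right n 1 ((t + b) / 2) ((t - b) / 2) s).add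
            (hasDerivAt_truncBinom_shift_right n 2 ((t + b) / 2) ((t - b) / 2) s))
          (fun s => hasDerivAt_const s 0)
          ((continuous_truncBinom _ _ (by fun_prop) (by fun_prop)).add
            (continuous_truncBinom _ _ (by fun_prop) (by fun_prop))) continuous_const
          (fun s hs => add_nonneg
            (truncBinom_nonneg _ _ (by linarith) (by linarith [hs.2]))
            (truncBinom_nonneg _ _ (by linarith) (by linarith [hs.2])))
          (by simp) (fun s hs => ?_) fun s hs => ?_).trans ?_
        · rw [hsecn s ⟨hs.1, by linarith [hs.2]⟩, if_pos (by linarith [hs.2]), maxTail,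
            show (t - s + (b + s)) / 2 = (t + b) / 2 by ring,
            show (t - s - (b + s)) / 2 = (t - b) / 2 - s by ring]
          norm_num
        · rw [hsecn s ⟨by linarith [hs.1], hs.2⟩, if_neg (by linarith [hs.1])]
        · congr 1
          simp only [Pi.add_apply, sub_self, sub_zero]
          rw [truncBinom_succ_right_zero n (by norm_num), truncBinom_succ_right_zero n
              (by norm_num)]
          ring
      · rw [if_neg hbt.not_gt]
        refine (interarrivalLaw_first_step (n := n) hlam le_rfl ht.le hEn
          (fun s => hasDerivAt_const s 0) (fun s => hasDerivAt_const s 0)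
          continuous_const continuous_const (by simp) (by simp) (by simp)
            fun s hs => ?_).trans (by simp)
        rw [hsecn s hs, if_neg (by linarith [hs.1])]

/-! ### Equality of the laws of maximum and absolute position -/

lemma measurableSet_hasCount_section (n : ℕ) (t : ℝ) : MeasurableSet {x | HasCount n t x} :=
  (measurable_const.prodMk measurable_id : Measurable fun x : ℕ → ℝ => (t, x))
    (measurableSet_hasCount n)

lemma measurable_pathEnd_section (n : ℕ) (t : ℝ) : Measurable (pathEnd n t) :=
  (measurable_pathEnd n).comp (measurable_const.prodMk measurable_id)

lemma measurable_pathMax_section (n : ℕ) (t : ℝ) : Measurable fun x => (pathMax n t x).1 :=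
  ((measurable_pathMax n).comp (measurable_const.prodMk measurable_id)).fst

lemma poissonWeight_add {lam : ℝ} (hlam : 0 < lam) (n : ℕ) (t : ℝ) {a b : ℝ} (ha : 0 ≤ a)
    (hb : 0 ≤ b) :
    poissonWeight lam n t (a + b) = poissonWeight lam n t a + poissonWeight lam n t b := by
  rw [poissonWeight, mul_add, ENNReal.ofReal_add (by positivity) (by positivity)]
  rfl

lemma maxTail_nonneg (n : ℕ) {t b : ℝ} (hb : 0 ≤ b) (hbt : b < t) : 0 ≤ maxTail n t b :=
  add_nonneg (truncBinom_nonneg _ _ (by linarith) (by linarith))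
    (truncBinom_nonneg _ _ (by linarith) (by linarith))

lemma maxTail_zero (n : ℕ) (t : ℝ) : maxTail n t 0 = t ^ n / (n.factorial : ℝ) := by
  have h := truncBinom_add_truncBinom_self n (t / 2)
  rw [show 2 * (t / 2) = t by ring] at h
  rw [maxTail, add_zero, sub_zero, h]

/-- The law of the maximum on the event of `n` reversals. -/
def maxLaw (lam : ℝ) (n : ℕ) (t : ℝ) : Measure ℝ :=
  ((interarrivalLaw lam).restrict {x | HasCount n t x}).map fun x => (pathMax n t x).1

/-- The law of the distance to the origin at time `t` on the event of `n` reversals. -/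
def absLaw (lam : ℝ) (n : ℕ) (t : ℝ) : Measure ℝ :=
  ((interarrivalLaw lam).restrict {x | HasCount n t x}).map fun x => |pathEnd n t x|

lemma maxLaw_apply (lam : ℝ) (n : ℕ) (t : ℝ) {B : Set ℝ} (hB : MeasurableSet B) :
    maxLaw lam n t B = interarrivalLaw lam {x | HasCount n t x ∧ (pathMax n t x).1 ∈ B} := by
  rw [maxLaw, Measure.map_apply (measurable_pathMax_section n t) hB,
    Measure.restrict_apply (measurable_pathMax_section n t hB), inter_comm]
  rfl

lemma absLaw_apply (lam : ℝ) (n : ℕ) (t : ℝ) {B : Set ℝ} (hB : MeasurableSet B) :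
    absLaw lam n t B = interarrivalLaw lam {x | HasCount n t x ∧ |pathEnd n t x| ∈ B} := by
  have hm : Measurable fun x => |pathEnd n t x| := (measurable_pathEnd_section n t).abs
  rw [absLaw, Measure.map_apply hm hB, Measure.restrict_apply (hm hB), inter_comm]
  rfl

lemma isFiniteMeasure_maxLaw {lam : ℝ} (hlam : 0 < lam) (n : ℕ) (t : ℝ) :
    IsFiniteMeasure (maxLaw lam n t) := by
  have := isProbabilityMeasure_interarrivalLaw hlam
  unfold maxLaw
  infer_instance

lemma isFiniteMeasure_absLaw {lam : ℝ} (hlam : 0 < lam) (n : ℕ) (t : ℝ) :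
    IsFiniteMeasure (absLaw lam n t) := by
  have := isProbabilityMeasure_interarrivalLaw hlam
  unfold absLaw
  infer_instance

lemma maxLaw_univ {lam : ℝ} (hlam : 0 < lam) (n : ℕ) {t : ℝ} (ht : 0 < t) :
    maxLaw lam n t univ = poissonWeight lam n t (t ^ n / (n.factorial : ℝ)) := by
  rw [maxLaw_apply _ _ _ .univ, ← interarrivalLaw_hasCount hlam n ht]
  simp

lemma absLaw_univ {lam : ℝ} (hlam : 0 < lam) (n : ℕ) {t : ℝ} (ht : 0 < t) :
    absLaw lam n t univ = poissonWeight lam n t (t ^ n / (n.factorial : ℝ)) := by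
  rw [absLaw_apply _ _ _ .univ, ← interarrivalLaw_hasCount hlam n ht]
  simp

lemma maxLaw_Ioi {lam : ℝ} (hlam : 0 < lam) (n : ℕ) {t b : ℝ} (ht : 0 < t) (hb : 0 ≤ b) :
    maxLaw lam n t (Ioi b) = poissonWeight lam n t (if b < t then maxTail n t b else 0) := by
  rw [maxLaw_apply _ _ _ measurableSet_Ioi]
  exact (interarrivalLaw_pathMax hlam n ht b).1 hb

lemma absLaw_Ioi {lam : ℝ} (hlam : 0 < lam) (n : ℕ) {t b : ℝ} (ht : 0 < t) (hb : 0 ≤ b) :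
    absLaw lam n t (Ioi b) = poissonWeight lam n t (if b < t then maxTail n t b else 0) := by
  rw [absLaw_apply _ _ _ measurableSet_Ioi]
  have hset : {x | HasCount n t x ∧ |pathEnd n t x| ∈ Ioi b} =
      {x | HasCount n t x ∧ b < pathEnd n t x} ∪ {x | HasCount n t x ∧ b < -pathEnd n t x} := by
    ext x
    simp only [mem_Ioi, mem_ofPred_eq, mem_union, lt_abs]
    tauto
  have hdis : Disjoint {x | HasCount n t x ∧ b < pathEnd n t x}
      {x | HasCount n t x ∧ b < -pathEnd n t x} := by
    rw [Set.disjoint_left]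
    intro x hx hx'
    have h1 := hx.2
    have h2 := hx'.2
    linarith
  have hmeas : MeasurableSet {x | HasCount n t x ∧ b < -pathEnd n t x} :=
    (measurableSet_hasCount_section n t).inter
      (measurableSet_lt measurable_const (measurable_pathEnd_section n t).neg)
  rw [hset, measure_union hdis hmeas, (interarrivalLaw_pathEnd hlam n ht b).1,
    (interarrivalLaw_pathEnd hlam n ht b).2, if_neg (show ¬b < -t by linarith),
    if_neg (show ¬b < -t by linarith)]
  split_ifs with hbt
  · rw [maxTail, poissonWeight_add hlam _ _ (truncBinom_nonneg _ _ (by linarith) (by linarith))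
      (truncBinom_nonneg _ _ (by linarith) (by linarith))]
  · simp

/-- The reflection principle on the event of `n` reversals. -/
lemma maxLaw_eq_absLaw {lam : ℝ} (hlam : 0 < lam) (n : ℕ) {t : ℝ} (ht : 0 < t) :
    maxLaw lam n t = absLaw lam n t := by
  have := isFiniteMeasure_maxLaw hlam n t
  have := isFiniteMeasure_absLaw hlam n t
  -- The tail formulas cover only `b ≥ 0`; below that no mass is missing, as `Ioi 0` already has
  -- full mass.
  have hfull : ∀ {ρ : Measure ℝ}, ρ univ = poissonWeight lam n t (t ^ n / (n.factorial : ℝ)) →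
      ρ (Ioi 0) = poissonWeight lam n t (if 0 < t then maxTail n t 0 else 0) → ∀ b < 0,
      ρ (Ioi b) = poissonWeight lam n t (t ^ n / (n.factorial : ℝ)) := by
    intro ρ hu h0 b hb
    rw [if_pos ht, maxTail_zero] at h0
    exact le_antisymm (hu ▸ measure_mono (subset_univ _))
      (h0 ▸ measure_mono (Ioi_subset_Ioi hb.le))
  have hIoi : ∀ b, maxLaw lam n t (Ioi b) = absLaw lam n t (Ioi b) := by
    intro b
    rcases lt_or_ge b 0 with hb | hb
    · rw [hfull (maxLaw_univ hlam n ht) (maxLaw_Ioi hlam n ht le_rfl) b hb,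
        hfull (absLaw_univ hlam n ht) (absLaw_Ioi hlam n ht le_rfl) b hb]
    · rw [maxLaw_Ioi hlam n ht hb, absLaw_Ioi hlam n ht hb]
  refine Measure.ext_of_Iic _ _ fun b => ?_
  rw [← compl_Ioi, measure_compl measurableSet_Ioi (measure_ne_top _ _),
    measure_compl measurableSet_Ioi (measure_ne_top _ _), hIoi, maxLaw_univ hlam n ht,
    absLaw_univ hlam n ht]

lemma interarrivalLaw_pathMax_mem_eq {lam : ℝ} (hlam : 0 < lam) (n : ℕ) {c t : ℝ} (hc : 0 < c)
    (ht : 0 < t) {B : Set ℝ} (hB : MeasurableSet B) :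
    interarrivalLaw lam {x | HasCount n t x ∧ c * (pathMax n t x).1 ∈ B} =
      interarrivalLaw lam {x | HasCount n t x ∧ |c * pathEnd n t x| ∈ B} := by
  have hB' : MeasurableSet ((fun x => c * x) ⁻¹' B) := measurable_const_mul c hB
  have h := congrArg (fun ρ : Measure ℝ => ρ ((fun x => c * x) ⁻¹' B)) (maxLaw_eq_absLaw hlam n ht)
  simp only [maxLaw_apply _ _ _ hB', absLaw_apply _ _ _ hB', mem_preimage] at h
  simpa only [abs_mul, abs_of_pos hc] using h

/-! ### Density and atom for a fixed number of reversals -/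

/-- A density of the maximum on the event of `n` reversals, from the derivative of the tail. -/
lemma interarrivalLaw_pathMax_mem_eq_lintegral {lam : ℝ} (hlam : 0 < lam) (n : ℕ) {c t : ℝ}
    (hc : 0 < c) (ht : 0 < t) {f : ℝ → ℝ} (hf : Continuous f)
    (hf0 : ∀ b, 0 < b → b < t → 0 ≤ f b) (hderiv : ∀ b, HasDerivAt (maxTail n t) (-f b) b)
    {B : Set ℝ} (hB : MeasurableSet B) (hBt : B ⊆ Ioo 0 (c * t)) :
    interarrivalLaw lam {x | HasCount n t x ∧ c * (pathMax n t x).1 ∈ B} =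
      ∫⁻ β in B, ENNReal.ofReal (Real.exp (-lam * t) * lam ^ n * (f (β / c) / c)) := by
  have := isFiniteMeasure_maxLaw hlam n t
  have hmc : Measurable fun x : ℝ => c * x := measurable_const_mul c
  have happ : ∀ {S : Set ℝ}, MeasurableSet S → (maxLaw lam n t).map (fun x => c * x) S =
      interarrivalLaw lam {x | HasCount n t x ∧ c * (pathMax n t x).1 ∈ S} := fun hS => by
    rw [Measure.map_apply hmc hS, maxLaw_apply _ _ _ (hmc hS)]
    rfl
  have hdiv : ∀ {b : ℝ}, b < c * t → b / c < t := fun h => by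
    rw [div_lt_iff₀ hc]; linarith
  rw [← happ hB]
  refine measure_eq_setLIntegral_of_tail (L := c * t)
    (F := fun b => Real.exp (-lam * t) * lam ^ n * maxTail n t (b / c))
    (fun b hb hbt => ?_) (fun b hb hbt => ?_) (fun b => ?_) (by fun_prop)
        (fun b hb hbt => ?_) hB hBt
  · have hpre : (fun x => c * x) ⁻¹' Ioi b = Ioi (b / c) := by
      ext x
      simp only [mem_preimage, mem_Ioi, div_lt_iff₀ hc, mul_comm]
    rw [Measure.map_apply hmc measurableSet_Ioi, hpre, maxLaw_Ioi hlam n ht (by positivity),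
      if_pos (hdiv hbt)]
    rfl
  · have := maxTail_nonneg n (div_nonneg hb hc.le) (hdiv hbt)
    positivity
  · refine (((hderiv (b / c)).comp b ((hasDerivAt_id b).div_const c)).const_mul _).congr_deriv ?_
    ring
  · have := hf0 (b / c) (by positivity) (hdiv hbt)
    positivity

lemma interarrivalLaw_pathMax_mem_odd {lam : ℝ} (hlam : 0 < lam) (k : ℕ) {c t : ℝ}
    (hc : 0 < c) (ht : 0 < t) {B : Set ℝ} (hB : MeasurableSet B) (hBt : B ⊆ Ioo 0 (c * t)) :
    interarrivalLaw lam {x | HasCount (2 * k + 1) t x ∧ c * (pathMax (2 * k + 1) t x).1 ∈ B} =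
      ∫⁻ β in B, ENNReal.ofReal (lam * Real.exp (-lam * t) / c *
        ((lam ^ 2 * ((t ^ 2 - (β / c) ^ 2) / 4)) ^ k / ((k.factorial : ℝ) * k.factorial))) := by
  rw [interarrivalLaw_pathMax_mem_eq_lintegral hlam _ hc ht (by fun_prop) (fun b hb hbt => ?_)
    (hasDerivAt_maxTail_odd k t) hB hBt]
  · refine lintegral_congr fun β => ?_
    congr 1
    rw [mul_pow]
    ring
  · have : 0 ≤ t ^ 2 - b ^ 2 := by nlinarith
    positivity

lemma interarrivalLaw_pathMax_mem_even {lam : ℝ} (hlam : 0 < lam) (k : ℕ) {c t : ℝ}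
    (hc : 0 < c) (ht : 0 < t) {B : Set ℝ} (hB : MeasurableSet B) (hBt : B ⊆ Ioo 0 (c * t)) :
    interarrivalLaw lam {x | HasCount (2 * k + 2) t x ∧ c * (pathMax (2 * k + 2) t x).1 ∈ B} =
      ∫⁻ β in B, ENNReal.ofReal (Real.exp (-lam * t) / c * (lam ^ 2 * t / 2) *
        ((lam ^ 2 * ((t ^ 2 - (β / c) ^ 2) / 4)) ^ k /
          ((k.factorial : ℝ) * (k + 1).factorial))) := by
  rw [interarrivalLaw_pathMax_mem_eq_lintegral hlam _ hc ht (by fun_prop) (fun b hb hbt => ?_)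
    (hasDerivAt_maxTail_even k t) hB hBt]
  · refine lintegral_congr fun β => ?_
    congr 1
    rw [mul_pow]
    ring
  · have : 0 ≤ t ^ 2 - b ^ 2 := by nlinarith
    positivity

lemma interarrivalLaw_pathMax_mem_zero {lam : ℝ} {c t : ℝ} {B : Set ℝ} (hBt : B ⊆ Ioo 0 (c * t)) :
    interarrivalLaw lam {x | HasCount 0 t x ∧ c * (pathMax 0 t x).1 ∈ B} = 0 := by
  have h : {x | HasCount 0 t x ∧ c * (pathMax 0 t x).1 ∈ B} = ∅ :=
    eq_empty_of_forall_notMem fun x hx => lt_irrefl _ (hBt hx.2).2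
  rw [h, measure_empty]

lemma maxTail_succ_self (n : ℕ) (t : ℝ) : maxTail (n + 1) t t = 0 := by
  rw [maxTail, sub_self, zero_div, truncBinom_succ_right_zero n le_rfl,
    truncBinom_succ_right_zero n zero_le_one, add_zero]

/-- The event lies in `{b < max}` for every `b < t`, and the tail tends to `maxTail (n + 1) t t = 0`
as `b` increases to `t`. -/
lemma interarrivalLaw_pathMax_eq_succ {lam : ℝ} (hlam : 0 < lam) (n : ℕ) {t : ℝ} (ht : 0 < t) :
    interarrivalLaw lam {x | HasCount (n + 1) t x ∧ (pathMax (n + 1) t x).1 = t} = 0 := by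
  have hlim : Filter.Tendsto (fun b => poissonWeight lam (n + 1) t (maxTail (n + 1) t b))
      (nhdsWithin t (Iio t)) (nhds 0) := by
    have hcont : Continuous fun b => poissonWeight lam (n + 1) t (maxTail (n + 1) t b) := by
      unfold poissonWeight
      refine ENNReal.continuous_ofReal.comp (continuous_const.mul ?_)
      exact (continuous_truncBinom _ _ (by fun_prop) (by fun_prop)).add
        (continuous_truncBinom _ _ (by fun_prop) (by fun_prop))
    have := hcont.tendsto t
    rw [maxTail_succ_self, poissonWeight_zero_right] at this
    exact this.mono_left nhdsWithin_le_nhds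
  refine le_antisymm (ge_of_tendsto hlim ?_) zero_le
  filter_upwards [Ioo_mem_nhdsLT ht] with b hb
  have h := maxLaw_Ioi hlam (n + 1) ht hb.1.le
  rw [if_pos hb.2, maxLaw_apply _ _ _ measurableSet_Ioi] at h
  rw [← h]
  exact measure_mono fun x hx => ⟨hx.1, hx.2.symm ▸ hb.2⟩

/-! ### Pathwise analysis of the telegraph process -/

/-- `f` counts the arrivals with interarrival times `x`. -/
structure IsCounting (x : ℕ → ℝ) (f : ℝ → ℕ) : Prop where
  nonneg : ∀ n, 0 ≤ x n
  monotone : Monotone f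
  count : ∀ s, 0 ≤ s → (f s : ℕ∞) = Set.encard {n : ℕ | ∑ i ∈ Finset.range (n + 1), x i ≤ s}

/-- The unit speed path started upwards with reversals counted by `f`. -/
def unitPath (f : ℝ → ℕ) (s : ℝ) : ℝ := ∫ r in (0 : ℝ)..s, (-1 : ℝ) ^ f r

lemma IsCounting.eq_zero_of_lt {x : ℕ → ℝ} {f : ℝ → ℕ} (h : IsCounting x f) {s : ℝ} (hs : 0 ≤ s)
    (hsx : s < x 0) : f s = 0 := by
  have hc := h.count s hs
  have he : {n : ℕ | ∑ i ∈ Finset.range (n + 1), x i ≤ s} = ∅ := by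
    refine eq_empty_of_forall_notMem fun n hn => ?_
    have := Finset.single_le_sum (fun i _ => h.nonneg i) (Finset.mem_range.2 n.succ_pos)
    exact absurd (this.trans hn) hsx.not_ge
  rw [he, encard_empty] at hc
  exact_mod_cast hc

lemma IsCounting.count_add {x : ℕ → ℝ} {f : ℝ → ℕ} (h : IsCounting x f) {s : ℝ} (hs : 0 ≤ s) :
    (f (s + x 0) : ℕ∞) =
      Set.encard {n : ℕ | ∑ i ∈ Finset.range (n + 1), seqShift x i ≤ s} + 1 := by
  rw [h.count _ (add_nonneg hs (h.nonneg 0))]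
  have hset : {n : ℕ | ∑ i ∈ Finset.range (n + 1), x i ≤ s + x 0} =
      insert 0 (Nat.succ '' {n : ℕ | ∑ i ∈ Finset.range (n + 1), seqShift x i ≤ s}) := by
    ext n
    cases n with
    | zero => simp [hs]
    | succ n =>
      rw [mem_ofPred_eq, Finset.sum_range_succ', add_le_add_iff_right]
      simp [seqShift]
  rw [hset, encard_insert_of_notMem (by simp), Nat.succ_injective.encard_image]

lemma IsCounting.one_le {x : ℕ → ℝ} {f : ℝ → ℕ} (h : IsCounting x f) {s : ℝ} (hs : 0 ≤ s) :
    1 ≤ f (s + x 0) := by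
  have := h.count_add hs
  have h1 : (1 : ℕ∞) ≤ f (s + x 0) := this ▸ le_add_self
  exact_mod_cast h1

/-- Restarting at the first arrival gives a counting function again. The truncated subtraction is
exact for `s ≥ 0`, where the first arrival has been counted, and it preserves monotonicity
everywhere. -/
lemma IsCounting.shift {x : ℕ → ℝ} {f : ℝ → ℕ} (h : IsCounting x f) :
    IsCounting (seqShift x) fun s => f (s + x 0) - 1 where
  nonneg n := h.nonneg (n + 1)
  monotone := fun a b hab => Nat.sub_le_sub_right (h.monotone (by simpa using hab)) 1
  count s hs := by
    have h1 := h.count_add hs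
    obtain ⟨k, hk⟩ := Nat.exists_eq_add_of_le' (h.one_le hs)
    rw [hk, Nat.cast_add, Nat.cast_one] at h1
    rw [hk, Nat.add_sub_cancel]
    exact (ENat.add_left_injective_of_ne_top (by simp)) h1

lemma intervalIntegrable_neg_one_pow {f : ℝ → ℕ} (hf : Monotone f) (a b : ℝ) :
    IntervalIntegrable (fun r => (-1 : ℝ) ^ f r) volume a b := by
  have hm : Measurable fun r => (-1 : ℝ) ^ f r :=
    (measurable_from_top (f := fun n : ℕ => (-1 : ℝ) ^ n)).comp hf.measurable
  refine (intervalIntegrable_const (c := (1 : ℝ))).mono_fun hm.aestronglyMeasurable ?_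
  exact .of_forall fun r => by simp

lemma continuous_unitPath {f : ℝ → ℕ} (hf : Monotone f) : Continuous (unitPath f) :=
  intervalIntegral.continuous_primitive (intervalIntegrable_neg_one_pow hf) 0

lemma IsCounting.unitPath_of_le {x : ℕ → ℝ} {f : ℝ → ℕ} (h : IsCounting x f) {s : ℝ} (hs : 0 ≤ s)
    (hsx : s ≤ x 0) : unitPath f s = s := by
  have hc : ∫ r in Ioo 0 s, (-1 : ℝ) ^ f r = ∫ r in Ioo 0 s, (1 : ℝ) :=
    setIntegral_congr_fun measurableSet_Ioo fun r hr => by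
      simp [h.eq_zero_of_lt hr.1.le (hr.2.trans_le hsx)]
  rw [unitPath, intervalIntegral.integral_of_le hs, integral_Ioc_eq_integral_Ioo, hc]
  simp [hs]

lemma IsCounting.unitPath_of_ge {x : ℕ → ℝ} {f : ℝ → ℕ} (h : IsCounting x f) {s : ℝ}
    (hsx : x 0 ≤ s) :
    unitPath f s = x 0 - unitPath (fun r => f (r + x 0) - 1) (s - x 0) := by
  have hsplit := intervalIntegral.integral_add_adjacent_intervals
    (intervalIntegrable_neg_one_pow h.monotone 0 (x 0))
    (intervalIntegrable_neg_one_pow h.monotone (x 0) s)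
  have hfirst := h.unitPath_of_le (h.nonneg 0) le_rfl
  have hsecond : ∫ r in x 0..s, (-1 : ℝ) ^ f r =
      -unitPath (fun r => f (r + x 0) - 1) (s - x 0) := by
    have hsh := intervalIntegral.integral_comp_add_right (a := 0) (b := s - x 0)
      (fun r => (-1 : ℝ) ^ f r) (x 0)
    rw [zero_add, sub_add_cancel] at hsh
    rw [← hsh, unitPath, ← intervalIntegral.integral_neg]
    refine intervalIntegral.integral_congr fun r hr => ?_
    rw [uIcc_of_le (sub_nonneg.2 hsx)] at hr
    obtain ⟨k, hk⟩ := Nat.exists_eq_add_of_le' (h.one_le hr.1)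
    simp only [hk, Nat.add_sub_cancel, pow_succ]
    ring
  unfold unitPath at hfirst ⊢
  linarith [hsplit, hfirst, hsecond, show unitPath (fun r => f (r + x 0) - 1) (s - x 0) =
    ∫ r in (0 : ℝ)..(s - x 0), (-1 : ℝ) ^ (f (r + x 0) - 1) from rfl]

lemma IsCounting.hasCount_iff (n : ℕ) : ∀ {x : ℕ → ℝ} {f : ℝ → ℕ}, IsCounting x f → ∀ {t : ℝ},
    0 ≤ t → (HasCount n t x ↔ f t = n) := by
  induction n with
  | zero =>
    intro x f h t ht
    refine ⟨fun hc => h.eq_zero_of_lt ht hc, fun hf => ?_⟩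
    by_contra hlt
    have := h.one_le (sub_nonneg.2 (not_lt.1 hlt))
    rw [sub_add_cancel] at this
    omega
  | succ n ih =>
    intro x f h t ht
    rcases lt_or_ge t (x 0) with hlt | hle
    · simp [HasCount, hlt.not_ge, h.eq_zero_of_lt ht hlt]
    · have h1 := h.one_le (sub_nonneg.2 hle)
      have h2 := ih h.shift (sub_nonneg.2 hle)
      rw [sub_add_cancel] at h1 h2
      rw [HasCount, h2]
      constructor
      · rintro ⟨-, h3⟩; omega
      · intro h3; exact ⟨hle, by omega⟩

/-- The maxima of the path and of its negative must be treated together, because the first reversal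
exchanges them. -/
lemma IsCounting.unitPath_spec (n : ℕ) : ∀ {x : ℕ → ℝ} {f : ℝ → ℕ}, IsCounting x f → ∀ {t : ℝ},
    0 ≤ t → f t = n → unitPath f t = pathEnd n t x ∧
      IsGreatest (unitPath f '' Icc 0 t) (pathMax n t x).1 ∧
      IsGreatest ((fun s => -unitPath f s) '' Icc 0 t) (pathMax n t x).2 := by
  induction n with
  | zero =>
    intro x f h t ht hf
    have hlt : t < x 0 := (h.hasCount_iff 0 ht).2 hf
    have hs : ∀ s ∈ Icc 0 t, unitPath f s = s := fun s hs =>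
      h.unitPath_of_le hs.1 (hs.2.trans hlt.le)
    refine ⟨hs t ⟨ht, le_rfl⟩, ⟨⟨t, ⟨ht, le_rfl⟩, hs t ⟨ht, le_rfl⟩⟩, ?_⟩,
      ⟨⟨0, ⟨le_rfl, ht⟩, ?_⟩, ?_⟩⟩
    · rintro _ ⟨s, hst, rfl⟩
      rw [hs s hst]
      exact hst.2
    · simp [unitPath, pathMax]
    · rintro _ ⟨s, hst, rfl⟩
      simp only [hs s hst, pathMax]
      linarith [hst.1]
  | succ n ih =>
    intro x f h t ht hf
    have hcount := (h.hasCount_iff (n + 1) ht).2 hf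
    have hle : x 0 ≤ t := hcount.1
    have ht' : 0 ≤ t - x 0 := sub_nonneg.2 hle
    have hx0 := h.nonneg 0
    obtain ⟨he, hp, hm⟩ := ih h.shift ht' (by rw [sub_add_cancel, hf, Nat.add_sub_cancel])
    set f' : ℝ → ℕ := fun r => f (r + x 0) - 1
    refine ⟨by rw [h.unitPath_of_ge hle, he, pathEnd], ⟨?_, ?_⟩, ⟨?_, ?_⟩⟩
    · obtain ⟨s, hs, hsm⟩ := hm.1
      refine ⟨s + x 0, ⟨by linarith [hs.1], by linarith [hs.2]⟩, ?_⟩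
      rw [h.unitPath_of_ge (by linarith [hs.1]), add_sub_cancel_right, pathMax]
      simp only at hsm ⊢
      linarith
    · rintro _ ⟨s, hs, rfl⟩
      simp only [pathMax]
      rcases le_total s (x 0) with h1 | h1
      · rw [h.unitPath_of_le hs.1 h1]
        linarith [pathMax_snd_nonneg n (t - x 0) (seqShift x)]
      · rw [h.unitPath_of_ge h1]
        have := hm.2 ⟨s - x 0, ⟨sub_nonneg.2 h1, by linarith [hs.2]⟩, rfl⟩
        simp only at this
        linarith
    · simp only [pathMax]
      rcases max_choice 0 ((pathMax n (t - x 0) (seqShift x)).1 - x 0) with h1 | h1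
      · rw [h1]
        exact ⟨0, ⟨le_rfl, ht⟩, by simp [unitPath]⟩
      · rw [h1]
        obtain ⟨s, hs, hsm⟩ := hp.1
        refine ⟨s + x 0, ⟨by linarith [hs.1], by linarith [hs.2]⟩, ?_⟩
        simp only
        rw [h.unitPath_of_ge (by linarith [hs.1]), add_sub_cancel_right]
        linarith
    · rintro _ ⟨s, hs, rfl⟩
      simp only [pathMax]
      rcases le_total s (x 0) with h1 | h1
      · rw [h.unitPath_of_le hs.1 h1]
        exact le_max_of_le_left (by linarith [hs.1])
      · rw [h.unitPath_of_ge h1]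
        have := hp.2 ⟨s - x 0, ⟨sub_nonneg.2 h1, by linarith [hs.2]⟩, rfl⟩
        exact le_max_of_le_right (by linarith)

lemma telegraph_eq {Ω : Type*} (V : Ω → ℝ) (N : ℝ≥0 → Ω → ℕ) (s : ℝ) (ω : Ω) :
    telegraph V N s ω = V ω * unitPath (fun r => N r.toNNReal ω) s := by
  rw [telegraph, intervalIntegral.integral_const_mul, unitPath]

lemma isGreatest_telegraphMax {Ω : Type*} (V : Ω → ℝ) (N : ℝ≥0 → Ω → ℕ) {t : ℝ} (ht : 0 ≤ t) {ω : Ω}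
    (hN : Monotone fun r : ℝ => N r.toNNReal ω) :
    IsGreatest ((fun s => telegraph V N s ω) '' Icc 0 t) (telegraphMax V N t ω) := by
  have hcont : Continuous fun s => telegraph V N s ω := by
    simp_rw [telegraph_eq]
    exact continuous_const.mul (continuous_unitPath hN)
  exact (isCompact_Icc.image hcont).isGreatest_sSup ((nonempty_Icc.2 ht).image _)

lemma telegraphMax_eq {Ω : Type*} {V : Ω → ℝ} {N : ℝ≥0 → Ω → ℕ} {t c : ℝ} (ht : 0 ≤ t) (hc : 0 < c)
    {ω : Ω} {x : ℕ → ℝ} (h : IsCounting x fun r => N r.toNNReal ω) (hV : V ω = c) :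
    telegraphMax V N t ω = c * (pathMax (N t.toNNReal ω) t x).1 := by
  have hg := (h.unitPath_spec _ ht rfl).2.1
  refine IsGreatest.csSup_eq ⟨?_, ?_⟩
  · obtain ⟨s, hs, hsm⟩ := hg.1
    exact ⟨s, hs, by simp only [telegraph_eq, hV, hsm]⟩
  · rintro _ ⟨s, hs, rfl⟩
    simp only [telegraph_eq, hV]
    exact mul_le_mul_of_nonneg_left (hg.2 ⟨s, hs, rfl⟩) hc.le

lemma ae_nonneg_expMeasure (lam : ℝ) : ∀ᵐ x ∂expMeasure lam, 0 ≤ x := by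
  have hpdf : expMeasure lam = volume.withDensity (exponentialPDF lam) := rfl
  rw [ae_iff, show {x : ℝ | ¬0 ≤ x} = Iio 0 by ext; simp, hpdf,
      withDensity_apply _ measurableSet_Iio,
    lintegral_exponentialPDF_of_nonpos le_rfl]

/-! ### Recovering the interarrival times from the process -/

/-- The time of arrival number `n` of a counting function, from its values at rational times. -/
def arrivalTime (n : ℕ) (f : ℝ≥0 → ℕ) : ℝ≥0∞ :=
  ⨆ q : ℚ, if f (q : ℝ).toNNReal ≤ n then ((q : ℝ).toNNReal : ℝ≥0∞) else 0

lemma measurable_arrivalTime (n : ℕ) : Measurable (arrivalTime n) := by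
  refine Measurable.iSup fun q => Measurable.ite ?_ measurable_const measurable_const
  exact (measurable_pi_apply (δ := ℝ≥0) (X := fun _ => ℕ) (q : ℝ).toNNReal)
    (measurableSet_Iic (a := n))

/-- Partial sums of nonnegative times are monotone, so the arrivals counted by time `s` form an
initial segment of the indices. -/
lemma IsCounting.le_iff {x : ℕ → ℝ} {f : ℝ → ℕ} (h : IsCounting x f) {s : ℝ} (hs : 0 ≤ s) (n : ℕ) :
    f s ≤ n ↔ s < ∑ i ∈ Finset.range (n + 1), x i := by
  have hmono : Monotone fun n : ℕ => ∑ i ∈ Finset.range (n + 1), x i := fun a b hab =>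
    Finset.sum_le_sum_of_subset_of_nonneg (Finset.range_mono (by omega)) fun i _ _ => h.nonneg i
  have hc := h.count s hs
  constructor
  · intro hn
    by_contra hlt
    have hsub : (Finset.range (n + 1) : Set ℕ) ⊆ {n : ℕ | ∑ i ∈ Finset.range (n + 1), x i ≤ s} := by
      intro m hm
      rw [Finset.coe_range, mem_Iio] at hm
      exact (hmono (Nat.lt_succ_iff.1 hm)).trans (not_lt.1 hlt)
    have := encard_le_encard hsub
    rw [encard_coe_eq_coe_finsetCard, Finset.card_range, ← hc] at this
    have : n + 1 ≤ f s := by exact_mod_cast this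
    omega
  · intro hlt
    have hsub : {n : ℕ | ∑ i ∈ Finset.range (n + 1), x i ≤ s} ⊆ (Finset.range n : Set ℕ) := by
      intro m hm
      rw [Finset.coe_range, mem_Iio]
      by_contra hmn
      exact absurd (hlt.trans_le ((hmono (not_lt.1 hmn)).trans hm)) (lt_irrefl _)
    have := encard_le_encard hsub
    rw [encard_coe_eq_coe_finsetCard, Finset.card_range, ← hc] at this
    exact_mod_cast this

/-- The times `s ≥ 0` with count at most `n` are those before the arrival with index `n`, and
rationals approach it from below. The default `0` and the clipping of negative rationals do not
affect the supremum. -/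
lemma IsCounting.arrivalTime_eq {x : ℕ → ℝ} {f : ℝ≥0 → ℕ} (h : IsCounting x fun r => f r.toNNReal)
    (n : ℕ) : arrivalTime n f = ENNReal.ofReal (∑ i ∈ Finset.range (n + 1), x i) := by
  have hq : ∀ q : ℚ, f (q : ℝ).toNNReal ≤ n →
      ((q : ℝ).toNNReal : ℝ≥0∞) ≤ ENNReal.ofReal (∑ i ∈ Finset.range (n + 1), x i) := by
    intro q hq
    rcases le_total (q : ℝ) 0 with h0 | h0
    · simp [Real.toNNReal_of_nonpos h0]
    · exact ENNReal.ofReal_le_ofReal ((h.le_iff h0 n).1 hq).le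
  refine le_antisymm (iSup_le fun q => ?_) (le_of_forall_lt fun a ha => ?_)
  · split_ifs with h1
    · exact hq q h1
    · exact zero_le
  · obtain ⟨q, hq0, haq, hqS⟩ := ENNReal.lt_iff_exists_rat_btwn.1 ha
    have hq0' : (0 : ℝ) ≤ q := by exact_mod_cast hq0
    have hlt : (q : ℝ) < ∑ i ∈ Finset.range (n + 1), x i :=
      (ENNReal.ofReal_lt_ofReal_iff_of_nonneg hq0').1 hqS
    refine haq.trans_le ((le_of_eq ?_).trans (le_iSup _ q))
    rw [if_pos ((h.le_iff hq0' n).2 hlt)]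

/-- The interarrival times of a counting function. -/
def interarrivalTimes (f : ℝ≥0 → ℕ) : ℕ → ℝ
  | 0 => (arrivalTime 0 f).toReal
  | n + 1 => (arrivalTime (n + 1) f).toReal - (arrivalTime n f).toReal

lemma measurable_interarrivalTimes : Measurable interarrivalTimes := by
  refine measurable_pi_lambda _ fun n => ?_
  cases n with
  | zero => exact (measurable_arrivalTime 0).ennreal_toReal
  | succ n =>
    exact (measurable_arrivalTime (n + 1)).ennreal_toReal.sub
      (measurable_arrivalTime n).ennreal_toReal

lemma IsCounting.interarrivalTimes_eq {x : ℕ → ℝ} {f : ℝ≥0 → ℕ}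
    (h : IsCounting x fun r => f r.toNNReal) : interarrivalTimes f = x := by
  have hS : ∀ n, (arrivalTime n f).toReal = ∑ i ∈ Finset.range (n + 1), x i := fun n => by
    rw [h.arrivalTime_eq, ENNReal.toReal_ofReal (Finset.sum_nonneg fun i _ => h.nonneg i)]
  ext n
  cases n with
  | zero => rw [interarrivalTimes, hS]; simp
  | succ n => rw [interarrivalTimes, hS, hS, Finset.sum_range_succ _ (n + 1)]; ring

/-- The interarrival times of a Poisson process are independent of all that is independent of the
process. -/
lemma IsPoissonProcess.exists_indepFun {Ω : Type*} [MeasurableSpace Ω] {P : Measure Ω}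
    {lam : ℝ} {V : Ω → ℝ} {N : ℝ≥0 → Ω → ℕ}
    (hN : IsPoissonProcess P lam N) (hVN : IndepFun V (fun ω s => N s ω) P) :
    ∃ ξ : Ω → ℕ → ℝ, Measurable ξ ∧ P.map ξ = interarrivalLaw lam ∧ IndepFun V ξ P ∧
      ∀ᵐ ω ∂P, IsCounting (ξ ω) fun r => N r.toNNReal ω := by
  obtain ⟨ξ, hm, hind, hlaw, hcount⟩ := hN.exists_interarrival
  have hnn : ∀ᵐ ω ∂P, ∀ n, 0 ≤ ξ n ω := ae_all_iff.2 fun n => by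
    have h := ae_nonneg_expMeasure lam
    rw [← (hlaw n).map_eq] at h
    exact ae_of_ae_map (hm n).aemeasurable h
  have hcounting : ∀ᵐ ω ∂P, IsCounting (fun n => ξ n ω) fun r => N r.toNNReal ω := by
    filter_upwards [hnn, hcount] with ω h0 hc
    refine ⟨h0, fun a b hab => ?_, fun s hs => ?_⟩
    · have h : (N a.toNNReal ω : ℕ∞) ≤ N b.toNNReal ω := by
        rw [hc, hc]
        refine encard_le_encard fun n hn => ?_
        rw [mem_ofPred_eq] at hn ⊢
        exact hn.trans (NNReal.coe_le_coe.2 (Real.toNNReal_le_toNNReal hab))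
      exact_mod_cast h
    · rw [hc, Real.coe_toNNReal s hs]
  refine ⟨fun ω n => ξ n ω, measurable_pi_lambda _ hm, ?_, ?_, hcounting⟩
  · rw [hind.map_fun_eq_infinitePi_map hm, interarrivalLaw]
    congr 1
    ext1 n
    exact (hlaw n).map_eq
  -- The given interarrival times agree almost surely with a measurable function of the whole
  -- process, so they inherit its independence of `V`.
  · refine (hVN.comp measurable_id measurable_interarrivalTimes).congr (.of_forall fun _ => rfl) ?_
    filter_upwards [hcounting] with ω h
    exact h.interarrivalTimes_eq

/-! ### Summation over the number of reversals and the initial velocity -/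

/-- Restricting the measure to `S` and splitting the whole space allows an arbitrary, possibly
non-measurable `S`. -/
lemma tsum_measure_inter_preimage {Ω : Type*} [MeasurableSpace Ω] (Q : Measure Ω) {N : Ω → ℕ}
    (hN : Measurable N) (S : Set Ω) : Q S = ∑' n, Q (S ∩ N ⁻¹' {n}) := by
  have hm : ∀ n, MeasurableSet (N ⁻¹' {n}) := fun n => hN (measurableSet_singleton n)
  have hU : (⋃ n, N ⁻¹' {n}) = univ := by ext; simp
  have hd : Pairwise (Function.onFun Disjoint fun n => N ⁻¹' {n}) := fun i j hij =>
    Disjoint.preimage N (disjoint_singleton.2 hij)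
  have h := measure_iUnion (μ := Q.restrict S) hd hm
  rw [hU, Measure.restrict_apply_univ] at h
  rw [h]
  exact tsum_congr fun n => by rw [Measure.restrict_apply (hm n), inter_comm]

lemma tsum_setLIntegral_ofReal {B : Set ℝ} (hB : MeasurableSet B) {h : ℕ → ℝ → ℝ}
    (hc : ∀ k, Continuous (h k)) (h0 : ∀ k, ∀ β ∈ B, 0 ≤ h k β)
    (hs : ∀ β ∈ B, Summable fun k => h k β) :
    ∑' k, ∫⁻ β in B, ENNReal.ofReal (h k β) = ∫⁻ β in B, ENNReal.ofReal (∑' k, h k β) := by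
  rw [← lintegral_tsum fun k => (hc k).measurable.ennreal_ofReal.aemeasurable]
  exact setLIntegral_congr_fun hB fun β hβ =>
    (ENNReal.ofReal_tsum_of_nonneg (fun k => h0 k β hβ) (hs β hβ)).symm

/-- The term `g 0` is split off because zero reversals contribute only the atom, while `2 * k + 2`
matches the `k`-th Bessel term. -/
lemma tsum_ite_even (g : ℕ → ℝ≥0∞) :
    (∑' n, if Even n then g n else 0) = g 0 + ∑' k, g (2 * k + 2) := by
  rw [← tsum_even_add_odd ENNReal.summable ENNReal.summable]
  have h : ∀ k : ℕ, ¬Even (2 * k + 1) := fun k => by simp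
  simp only [h, if_false, tsum_zero, add_zero, even_two_mul, if_true]
  rw [tsum_eq_zero_add' ENNReal.summable]
  simp only [mul_zero, mul_add, mul_one]

lemma tsum_ite_odd (g : ℕ → ℝ≥0∞) :
    (∑' n, if Odd n then g n else 0) = ∑' k, g (2 * k + 1) := by
  rw [← tsum_even_add_odd ENNReal.summable ENNReal.summable]
  have h : ∀ k : ℕ, ¬Odd (2 * k) := fun k => by simp
  simp only [h, if_false, tsum_zero, zero_add, odd_two_mul_add_one, if_true]

/-- The independent initial velocity can be integrated out. -/
lemma measure_inter_eq_mul_of_indepFun {Ω : Type*} [MeasurableSpace Ω] {P : Measure Ω} {lam : ℝ}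
    {V : Ω → ℝ} {ξ : Ω → ℕ → ℝ} (hξ : Measurable ξ) (hlaw : P.map ξ = interarrivalLaw lam)
    (hind : IndepFun V ξ P) {v : ℝ} {S : Set Ω} {E : Set (ℕ → ℝ)} (hE : MeasurableSet E)
    (h : ∀ᵐ ω ∂P, V ω = v → (ω ∈ S ↔ ξ ω ∈ E)) :
    P (V ⁻¹' {v} ∩ S) = P (V ⁻¹' {v}) * interarrivalLaw lam E := by
  rw [← hlaw, Measure.map_apply hξ hE,
    ← hind.measure_inter_preimage_eq_mul _ _ (measurableSet_singleton v) hE]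
  refine measure_congr ?_
  filter_upwards [h] with ω hω
  exact propext (and_congr_right fun hv => hω hv)

lemma measurableSet_hasCount_pathEnd (n : ℕ) (t v : ℝ) {D : Set ℝ} (hD : MeasurableSet D) :
    MeasurableSet {x | HasCount n t x ∧ v * pathEnd n t x ∈ D} :=
  (measurableSet_hasCount_section n t).inter
    (((measurable_pathEnd_section n t).const_mul v) hD)

lemma measurableSet_hasCount_pathMax (n : ℕ) (t v : ℝ) {D : Set ℝ} (hD : MeasurableSet D) :
    MeasurableSet {x | HasCount n t x ∧ v * (pathMax n t x).1 ∈ D} :=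
  (measurableSet_hasCount_section n t).inter
    (((measurable_pathMax_section n t).const_mul v) hD)

/-! ### Laws of the telegraph process and of its maximum -/

section Telegraph

variable {Ω : Type*} [MeasurableSpace Ω] {P : Measure Ω} {c lam t : ℝ} {V : Ω → ℝ}
  {N : ℝ≥0 → Ω → ℕ}

/-- The law of the maximum and of the number of reversals, given the initial velocity. -/
lemma cond_telegraphMax_inter (hc : 0 < c) (ht : 0 < t) (hV : Measurable V)
    (hVpos : P (V ⁻¹' {c}) = 1 / 2) (hN : IsPoissonProcess P lam N)
    (hVN : IndepFun V (fun ω s => N s ω) P) {B : Set ℝ} (hB : MeasurableSet B) (n : ℕ) :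
    P[|V ⁻¹' {c}] (telegraphMax V N t ⁻¹' B ∩ N t.toNNReal ⁻¹' {n}) =
      interarrivalLaw lam {x | HasCount n t x ∧ c * (pathMax n t x).1 ∈ B} := by
  obtain ⟨ξ, hξ, hlaw, hind, hcount⟩ := hN.exists_indepFun hVN
  rw [cond_apply (hV (measurableSet_singleton c)), measure_inter_eq_mul_of_indepFun hξ hlaw hind
    (measurableSet_hasCount_pathMax n t c hB), ← mul_assoc, ENNReal.inv_mul_cancel, one_mul]
  · simp [hVpos]
  · simp [hVpos]
  · filter_upwards [hcount] with ω hω hv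
    have h1 := hω.hasCount_iff n ht.le
    have h2 := telegraphMax_eq ht.le hc hω hv
    simp only [mem_inter_iff, mem_preimage, mem_singleton_iff, h1]
    rw [and_comm]
    refine and_congr_right fun hn => ?_
    rw [h2, hn]

/-- The law of the position, for a symmetric initial velocity. -/
lemma measure_telegraph_preimage [IsProbabilityMeasure P] (hc : 0 < c) (ht : 0 < t)
    (hV : Measurable V) (hVpos : P (V ⁻¹' {c}) = 1 / 2) (hVneg : P (V ⁻¹' {-c}) = 1 / 2)
    (hN : IsPoissonProcess P lam N) (hVN : IndepFun V (fun ω s => N s ω) P) {D : Set ℝ}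
    (hD : MeasurableSet D) :
    P (telegraph V N t ⁻¹' D) = 1 / 2 *
      ((∑' n, interarrivalLaw lam {x | HasCount n t x ∧ c * pathEnd n t x ∈ D}) +
        ∑' n, interarrivalLaw lam {x | HasCount n t x ∧ c * pathEnd n t x ∈ -D}) := by
  obtain ⟨ξ, hξ, hlaw, hind, hcount⟩ := hN.exists_indepFun hVN
  have hone : ∀ v : ℝ, ∀ n : ℕ,
      P (V ⁻¹' {v} ∩ (telegraph V N t ⁻¹' D ∩ N t.toNNReal ⁻¹' {n})) =
      P (V ⁻¹' {v}) * interarrivalLaw lam {x | HasCount n t x ∧ v * pathEnd n t x ∈ D} := by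
    intro v n
    refine measure_inter_eq_mul_of_indepFun hξ hlaw hind
      (measurableSet_hasCount_pathEnd n t v hD) ?_
    filter_upwards [hcount] with ω hω hv
    have h1 := hω.hasCount_iff n ht.le
    have h2 := (hω.unitPath_spec _ ht.le rfl).1
    simp only [mem_inter_iff, mem_preimage, mem_singleton_iff, h1]
    rw [and_comm]
    refine and_congr_right fun hn => ?_
    rw [telegraph_eq, hv, h2, hn]
  have hmc := hV (measurableSet_singleton c)
  have hmc' := hV (measurableSet_singleton (-c))
  have hdisj : Disjoint (V ⁻¹' {c}) (V ⁻¹' {-c}) :=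
    Disjoint.preimage V (disjoint_singleton.2 (by linarith))
  have hfull : ∀ᵐ ω ∂P, ω ∈ V ⁻¹' {c} ∪ V ⁻¹' {-c} := by
    refine (mem_ae_iff_prob_eq_one (hmc.union hmc')).2 ?_
    rw [measure_union hdisj hmc', hVpos, hVneg, ENNReal.add_halves]
  -- The two values of `V` exhaust the probability; restricting `P` to `S` again avoids
  -- measurability of `S`.
  have hsplit : ∀ S : Set Ω, P S = P (V ⁻¹' {c} ∩ S) + P (V ⁻¹' {-c} ∩ S) := by
    intro S
    have h := measure_union (μ := P.restrict S) hdisj hmc'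
    rw [Measure.restrict_apply hmc, Measure.restrict_apply hmc',
      Measure.restrict_apply (hmc.union hmc')] at h
    rw [← h]
    refine measure_congr ?_
    filter_upwards [hfull] with ω hω
    exact propext ⟨fun hS => ⟨hω, hS⟩, fun hS => hS.2⟩
  rw [tsum_measure_inter_preimage P (hN.measurable t.toNNReal), ← ENNReal.tsum_add,
    ← ENNReal.tsum_mul_left]
  refine tsum_congr fun n => ?_
  rw [hsplit, hone, hone, hVpos, hVneg, mul_add]
  simp only [neg_mul, Set.mem_neg]

/-- The law of the maximum is the folded law of the position. -/
lemma cond_telegraphMax_preimage (hc : 0 < c) (hlam : 0 < lam) (ht : 0 < t) (hV : Measurable V)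
    (hVpos : P (V ⁻¹' {c}) = 1 / 2) (hN : IsPoissonProcess P lam N)
    (hVN : IndepFun V (fun ω s => N s ω) P) {B : Set ℝ} (hB : MeasurableSet B) :
    P[|V ⁻¹' {c}] (telegraphMax V N t ⁻¹' B) =
      ∑' n, interarrivalLaw lam {x | HasCount n t x ∧ c * pathEnd n t x ∈ abs ⁻¹' B} := by
  rw [tsum_measure_inter_preimage _ (hN.measurable t.toNNReal)]
  refine tsum_congr fun n => ?_
  rw [cond_telegraphMax_inter hc ht hV hVpos hN hVN hB,
      interarrivalLaw_pathMax_mem_eq hlam n hc ht hB]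
  rfl

lemma besselSeries_nonneg (j : ℕ) {y : ℝ} (hy : 0 ≤ y) : 0 ≤ besselSeries j y :=
  tsum_nonneg fun k => by positivity

lemma continuous_besselSeries (j : ℕ) : Continuous (besselSeries j) :=
  continuous_iff_continuousAt.2 fun y => (hasDerivAt_besselSeries j y).continuousAt

lemma besselArg_nonneg {β : ℝ} (hc : 0 < c) (hβ : β ∈ Ioo 0 (c * t)) :
    0 ≤ lam ^ 2 * ((t ^ 2 - (β / c) ^ 2) / 4) := by
  have h := sq_sub_sq_pos_of_mem_Ioo hβ
  have : t ^ 2 - (β / c) ^ 2 = (c ^ 2 * t ^ 2 - β ^ 2) / c ^ 2 := by field_simp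
  rw [this]
  positivity

lemma hasDensityOn_telegraphMax_even (hc : 0 < c) (hlam : 0 < lam) (ht : 0 < t) (hV : Measurable V)
    (hVpos : P (V ⁻¹' {c}) = 1 / 2) (hN : IsPoissonProcess P lam N)
    (hVN : IndepFun V (fun ω s => N s ω) P) :
    HasDensityOn (P[|V ⁻¹' {c}]) (telegraphMax V N t) {ω | Even (N t.toNNReal ω)} (Ioo 0 (c * t))
      (fun β => Real.exp (-lam * t) / c * (lam ^ 2 * t / 2) *
        besselSeries 1 (lam ^ 2 * ((t ^ 2 - (β / c) ^ 2) / 4))) where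
  nonneg β hβ := mul_nonneg (by positivity) (besselSeries_nonneg 1 (besselArg_nonneg hc hβ))
  aemeasurable := (continuous_const.mul ((continuous_besselSeries 1).comp
    (by fun_prop))).measurable.aemeasurable
  measure_eq B hB hBt := by
    rw [tsum_measure_inter_preimage _ (hN.measurable t.toNNReal)]
    have hterm : ∀ n, P[|V ⁻¹' {c}] (telegraphMax V N t ⁻¹' B ∩ {ω | Even (N t.toNNReal ω)} ∩
        N t.toNNReal ⁻¹' {n}) = if Even n then
          interarrivalLaw lam {x | HasCount n t x ∧ c * (pathMax n t x).1 ∈ B} else 0 := by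
      intro n
      split_ifs with hn
      · rw [← cond_telegraphMax_inter hc ht hV hVpos hN hVN hB]
        congr 1
        ext ω
        simp only [mem_inter_iff, mem_preimage, mem_ofPred_eq, mem_singleton_iff]
        exact ⟨fun h => ⟨h.1.1, h.2⟩, fun h => ⟨⟨h.1, h.2 ▸ hn⟩, h.2⟩⟩
      · convert! measure_empty (μ := P[|V ⁻¹' {c}])
        exact eq_empty_of_forall_notMem fun ω hω => hn (hω.2 ▸ hω.1.2)
    simp_rw [hterm]
    rw [tsum_ite_even, interarrivalLaw_pathMax_mem_zero hBt, zero_add]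
    simp_rw [interarrivalLaw_pathMax_mem_even hlam _ hc ht hB hBt]
    rw [tsum_setLIntegral_ofReal hB (fun k => by fun_prop)
      (fun k β hβ => mul_nonneg (by positivity)
        (div_nonneg (pow_nonneg (besselArg_nonneg hc (hBt hβ)) k) (by positivity)))
      (fun β _ => (summable_besselSeries 1 _).mul_left _)]
    simp_rw [tsum_mul_left]
    rfl

lemma hasDensityOn_telegraphMax_odd (hc : 0 < c) (hlam : 0 < lam) (ht : 0 < t) (hV : Measurable V)
    (hVpos : P (V ⁻¹' {c}) = 1 / 2) (hN : IsPoissonProcess P lam N)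
    (hVN : IndepFun V (fun ω s => N s ω) P) :
    HasDensityOn (P[|V ⁻¹' {c}]) (telegraphMax V N t) {ω | Odd (N t.toNNReal ω)} (Ioo 0 (c * t))
      (fun β => lam * Real.exp (-lam * t) / c *
        besselSeries 0 (lam ^ 2 * ((t ^ 2 - (β / c) ^ 2) / 4))) where
  nonneg β hβ := mul_nonneg (by positivity) (besselSeries_nonneg 0 (besselArg_nonneg hc hβ))
  aemeasurable := (continuous_const.mul ((continuous_besselSeries 0).comp
    (by fun_prop))).measurable.aemeasurable
  measure_eq B hB hBt := by
    rw [tsum_measure_inter_preimage _ (hN.measurable t.toNNReal)]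
    have hterm : ∀ n, P[|V ⁻¹' {c}] (telegraphMax V N t ⁻¹' B ∩ {ω | Odd (N t.toNNReal ω)} ∩
        N t.toNNReal ⁻¹' {n}) = if Odd n then
          interarrivalLaw lam {x | HasCount n t x ∧ c * (pathMax n t x).1 ∈ B} else 0 := by
      intro n
      split_ifs with hn
      · rw [← cond_telegraphMax_inter hc ht hV hVpos hN hVN hB]
        congr 1
        ext ω
        simp only [mem_inter_iff, mem_preimage, mem_ofPred_eq, mem_singleton_iff]
        exact ⟨fun h => ⟨h.1.1, h.2⟩, fun h => ⟨⟨h.1, h.2 ▸ hn⟩, h.2⟩⟩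
      · convert! measure_empty (μ := P[|V ⁻¹' {c}])
        exact eq_empty_of_forall_notMem fun ω hω => hn (hω.2 ▸ hω.1.2)
    simp_rw [hterm]
    have hsum : ∀ y : ℝ, Summable fun k : ℕ => y ^ k / ((k.factorial : ℝ) * k.factorial) :=
      summable_besselSeries 0
    rw [tsum_ite_odd]
    simp_rw [interarrivalLaw_pathMax_mem_odd hlam _ hc ht hB hBt]
    rw [tsum_setLIntegral_ofReal hB (fun k => by fun_prop)
      (fun k β hβ => mul_nonneg (by positivity)
        (div_nonneg (pow_nonneg (besselArg_nonneg hc (hBt hβ)) k) (by positivity)))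
      (fun β _ => (hsum _).mul_left _)]
    simp_rw [tsum_mul_left]
    rfl

lemma HasDensityOn.congr {Q : Measure Ω} {X : Ω → ℝ} {A : Set Ω} {I : Set ℝ} {f g : ℝ → ℝ}
    (h : HasDensityOn Q X A I f) (hI : MeasurableSet I) (hfg : ∀ x ∈ I, f x = g x) :
    HasDensityOn Q X A I g where
  nonneg x hx := hfg x hx ▸ h.nonneg x hx
  aemeasurable := h.aemeasurable.congr ((ae_restrict_iff' hI).2 (.of_forall hfg))
  measure_eq B hB hBI := by
    rw [h.measure_eq B hB hBI]
    exact setLIntegral_congr_fun hB fun x hx => by rw [hfg x (hBI hx)]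

lemma HasDensityOn.add_compl {Q : Measure Ω} {X : Ω → ℝ} {A A' : Set Ω} {I : Set ℝ} {f g : ℝ → ℝ}
    (hf : HasDensityOn Q X A I f) (hg : HasDensityOn Q X A' I g) (hA : MeasurableSet A)
    (hA' : A' = Aᶜ) : HasDensityOn Q X univ I (fun x => f x + g x) where
  nonneg x hx := add_nonneg (hf.nonneg x hx) (hg.nonneg x hx)
  aemeasurable := hf.aemeasurable.add hg.aemeasurable
  measure_eq B hB hBI := by
    have hadd : ∫⁻ x in B, ENNReal.ofReal (f x + g x) =
        ∫⁻ x in B, (ENNReal.ofReal (f x) + ENNReal.ofReal (g x)) :=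
      setLIntegral_congr_fun hB fun x hx =>
        ENNReal.ofReal_add (hf.nonneg x (hBI hx)) (hg.nonneg x (hBI hx))
    rw [hadd, lintegral_add_left' (hf.aemeasurable.mono_set hBI).ennreal_ofReal,
      ← hf.measure_eq B hB hBI, ← hg.measure_eq B hB hBI, inter_univ, hA', ← sdiff_eq,
      measure_inter_add_sdiff _ hA]

end Telegraph

end

theorem mainTheorem5 {Ω : Type*} [MeasurableSpace Ω] (P : Measure Ω) [IsProbabilityMeasure P]
    (c lam t : ℝ) (hc : 0 < c) (hlam : 0 < lam) (ht : 0 < t)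
    (V : Ω → ℝ) (hV : Measurable V)
    (hVpos : P (V ⁻¹' {c}) = 1 / 2) (hVneg : P (V ⁻¹' {-c}) = 1 / 2)
    (N : ℝ≥0 → Ω → ℕ) (hN : IsPoissonProcess P lam N)
    (hVN : IndepFun V (fun ω s => N s ω) P) :
    -- the maximum is attained
    (∀ᵐ ω ∂P, IsGreatest ((fun s => telegraph V N s ω) '' Icc 0 t) (telegraphMax V N t ω)) ∧
    -- the time derivative of the Bessel function exists, and its value
    (∀ β ∈ Ioo 0 (c * t), HasDerivAt (fun u => besselKernel lam c u β)
      (c * (lam * t / Real.sqrt (c ^ 2 * t ^ 2 - β ^ 2) *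
        besselI 1 (lam / c * Real.sqrt (c ^ 2 * t ^ 2 - β ^ 2)))) t) ∧
    -- even number of reversals
    HasDensityOn (P[|V ⁻¹' {c}]) (telegraphMax V N t) {ω | Even (N t.toNNReal ω)}
      (Ioo 0 (c * t))
      (fun β => Real.exp (-lam * t) / c * deriv (fun u => besselKernel lam c u β) t) ∧
    -- odd number of reversals
    HasDensityOn (P[|V ⁻¹' {c}]) (telegraphMax V N t) {ω | Odd (N t.toNNReal ω)}
      (Ioo 0 (c * t))
      (fun β => lam * Real.exp (-lam * t) / c * besselKernel lam c t β) ∧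
    -- the density of the maximum
    HasDensityOn (P[|V ⁻¹' {c}]) (telegraphMax V N t) univ (Ioo 0 (c * t))
      (fun β => Real.exp (-lam * t) / c *
        (lam * besselKernel lam c t β + deriv (fun u => besselKernel lam c u β) t)) ∧
    -- reflection principle
    (∀ B : Set ℝ, MeasurableSet B → B ⊆ Ioo 0 (c * t) →
      P[|V ⁻¹' {c}] (telegraphMax V N t ⁻¹' B) = 2 * P (telegraph V N t ⁻¹' B)) ∧
    -- the law of the maximum is the folded law of the process
    (∀ B : Set ℝ, MeasurableSet B →
      P[|V ⁻¹' {c}] (telegraphMax V N t ⁻¹' B) = P ((fun ω => |telegraph V N t ω|) ⁻¹' B)) ∧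
    -- the singular component
    P[|V ⁻¹' {c}] (telegraphMax V N t ⁻¹' {c * t}) = ENNReal.ofReal (Real.exp (-lam * t)) := by
  have hkernel : ∀ β ∈ Ioo 0 (c * t),
      besselSeries 0 (lam ^ 2 * ((t ^ 2 - (β / c) ^ 2) / 4)) = besselKernel lam c t β :=
    fun β hβ => (besselKernel_eq hc (sq_sub_sq_pos_of_mem_Ioo hβ).le).symm
  have heven := (hasDensityOn_telegraphMax_even hc hlam ht hV hVpos hN hVN).congr measurableSet_Ioo
    (g := fun β => Real.exp (-lam * t) / c * deriv (fun u => besselKernel lam c u β) t)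
    fun β hβ => by rw [(hasDerivAt_besselKernel hc hβ).deriv, mul_assoc]
  have hodd := (hasDensityOn_telegraphMax_odd hc hlam ht hV hVpos hN hVN).congr measurableSet_Ioo
    (g := fun β => lam * Real.exp (-lam * t) / c * besselKernel lam c t β)
    fun β hβ => by rw [hkernel β hβ]
  have hEven : MeasurableSet {ω | Even (N t.toNNReal ω)} :=
    hN.measurable t.toNNReal (MeasurableSet.of_discrete (s := {n | Even n}))
  have hfold : ∀ B : Set ℝ, MeasurableSet B → P[|V ⁻¹' {c}] (telegraphMax V N t ⁻¹' B) =
      P ((fun ω => |telegraph V N t ω|) ⁻¹' B) := by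
    intro B hB
    have hpre : (fun ω => |telegraph V N t ω|) ⁻¹' B = telegraph V N t ⁻¹' (abs ⁻¹' B) := rfl
    -- For a symmetric set both initial velocities contribute equally, which absorbs the factor `1 /
    -- 2`.
    have hneg : -(abs ⁻¹' B : Set ℝ) = abs ⁻¹' B := by ext x; simp
    rw [cond_telegraphMax_preimage hc hlam ht hV hVpos hN hVN hB, hpre,
      measure_telegraph_preimage hc ht hV hVpos hVneg hN hVN (measurable_abs hB), hneg, ← two_mul,
      ← mul_assoc, one_div, ENNReal.inv_mul_cancel two_ne_zero ENNReal.ofNat_ne_top, one_mul]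
  refine ⟨?_, ?_, heven, hodd, ?_, ?_, hfold, ?_⟩
  · obtain ⟨ξ, -, -, -, hcount⟩ := hN.exists_indepFun hVN
    filter_upwards [hcount] with ω hω
    exact isGreatest_telegraphMax V N ht.le hω.monotone
  · intro β hβ
    rw [besselI_one_sqrt hc hβ]
    exact hasDerivAt_besselKernel hc hβ
  · refine (heven.add_compl hodd hEven ?_).congr measurableSet_Ioo fun β _ => by ring
    ext ω
    simp
  · intro B hB hBt
    rw [cond_telegraphMax_preimage hc hlam ht hV hVpos hN hVN hB,
      measure_telegraph_preimage hc ht hV hVpos hVneg hN hVN hB, ← mul_assoc, one_div,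
      ENNReal.mul_inv_cancel two_ne_zero ENNReal.ofNat_ne_top, one_mul, ← ENNReal.tsum_add]
    refine tsum_congr fun n => ?_
    -- As `B` lies in the positive half-line, its preimage under `abs` is the disjoint union of `B`
    -- and `-B`, the two sets in the law of the position.
    have hset : {x | HasCount n t x ∧ c * pathEnd n t x ∈ abs ⁻¹' B} =
        {x | HasCount n t x ∧ c * pathEnd n t x ∈ B} ∪
          {x | HasCount n t x ∧ c * pathEnd n t x ∈ -B} := by
      ext x
      simp only [mem_ofPred_eq, mem_union, mem_preimage, Set.mem_neg, ← and_or_left]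
      refine and_congr_right fun _ => ⟨fun h => ?_, ?_⟩
      · rcases abs_choice (c * pathEnd n t x) with h' | h' <;> rw [h'] at h
        · exact Or.inl h
        · exact Or.inr h
      · rintro (h | h)
        · rwa [abs_of_pos (hBt h).1]
        · rwa [abs_of_neg (neg_pos.1 (hBt h).1)]
    rw [hset, measure_union _ (measurableSet_hasCount_pathEnd n t c hB.neg)]
    rw [Set.disjoint_left]
    intro x hx hx'
    have h1 := (hBt hx.2).1
    have h2 := (hBt (Set.mem_neg.1 hx'.2)).1
    linarith
  · have hterm : ∀ n, {x | HasCount n t x ∧ c * (pathMax n t x).1 ∈ ({c * t} : Set ℝ)} =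
        {x | HasCount n t x ∧ (pathMax n t x).1 = t} := fun n => by
      ext x
      simp only [mem_ofPred_eq, mem_singleton_iff, mul_right_inj' hc.ne']
    rw [tsum_measure_inter_preimage _ (hN.measurable t.toNNReal)]
    simp_rw [cond_telegraphMax_inter hc ht hV hVpos hN hVN (measurableSet_singleton (c * t)), hterm]
    -- Only the path without reversals charges the level `c * t`; every other term is null.
    rw [tsum_eq_zero_add' ENNReal.summable]
    simp_rw [interarrivalLaw_pathMax_eq_succ hlam _ ht, tsum_zero, add_zero]
    rw [← measure_interarrivalLaw_lt hlam ht.le]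
    congr 1
    ext x
    simp [HasCount, pathMax]
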